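/- Let $n\ge 2$ and let $J^k$ be the space of $k$-jets of plane curves, in coordinates $(x,y_0,\dots,y_k)$ induced by local coordinates $(x,y)$ on the plane, so that the graph of $y(x)$ lifts to $(x,y(x),\dots,y^{(k)}(x))$. Let $C^k$ be its contact distribution, spanned by $\partial_{y_k}$ and $\partial_x+y_1\partial_{y_0}+\dots+y_k\partial_{y_{k-1}}$, and let $\pi_{k,l}\colon J^k\to J^l$ be the projections. Let $\mathcal E=\{y_{n+1}=f(x,y_0,\dots,y_n)\}\subset J^{n+1}$ be an ordinary differential equation, with $f$ smooth on an open set of $J^n$. Put $E_p=T_p\mathcal E\cap C^{n+1}_p$, the line field tangent to the lifted solutions, generated by $D=\partial_x+y_1\partial_{y_0}+\dots+y_n\partial_{y_{n-1}}+f\partial_{y_n}$. The normal bundle $N=T\mathcal E/E$ has the filtration $N_i=(\pi_{n+1,i}^*C^i\cap T\mathcal E)/E$, $i=0,\dots,n$, and the partial connection $\nabla_D(S+E)=[D,S]+E$ along $E$. Let $V_n$ be the space of binary forms of degree $n$ in $v_1,v_2$, with basis $E_j=v_1^{n-j}v_2^j$ ($j=0,\dots,n$), on which $\mathfrak{gl}(2,\mathbb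 R)$ acts by $X=v_1\partial_{v_2}$, $Y=v_2\partial_{v_1}$, $H=v_1\partial_{v_1}-v_2\partial_{v_2}$, $Z=v_1\partial_{v_1}+v_2\partial_{v_2}$. A normal frame on an open subset of $\mathcal E$ is a smooth family of isomorphisms $V_n\to N$ that map $\langle E_i,\dots,E_n\rangle$ onto $N_i$ for all $i$, and in which the matrix of $\nabla_D$ (the connection form evaluated on $D$) is $$-X+\alpha H+\beta Z+\gamma Y+\sum_{i=2}^{n}\theta_{i+1}Y^i$$ for some functions $\alpha,\beta,\gamma,\theta_3,\dots,\theta_{n+1}$. Then for $i=3,\dots,n+1$: (a) Near every point of $\mathcal E$ there is a normal frame, the value of $\theta_i$ at a point of $\mathcal E$ is the same for all normal frames near that point, and the function $W_i$ on $\mathcal E$ so defined is smooth. Hence $\mathcal W_i(D,\dots,D)=W_i$ defines a smooth section $\mathcal W_i$ of $S^iE^*$, the $i$-th generalized Wilczynski invariant of $\mathcal E$. (b) Let $\overline{\mathcal E}=\{y_{n+1}=\overline f(x,y_0,\dots,y_n)\}$ be a second equation of this kind, with line field $\overline E$ and invariants $\overline{\mathcal W}_i$, and let $\phi$ be a local contact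 transformation of $J^{n+1}$ (a smooth diffeomorphism between open subsets with $\phi_*C^{n+1}=C^{n+1}$) that establishes a local equivalence of $\mathcal E$ and $\overline{\mathcal E}$, i.e. a point $p$ of its domain lies in $\mathcal E$ if and only if $\phi(p)$ lies in $\overline{\mathcal E}$. Then, at every point of $\mathcal E$ in the domain of $\phi$, $\phi_*E=\overline E$ and $\phi^*\overline{\mathcal W}_i=\mathcal W_i$. -/

import Mathlib

open scoped ContDiff

noncomputable section

namespace GenWilczynski

/-- The jet space `J^k` of plane curves in the coordinates `(x, y_0, …, y_k)` induced by local
coordinates `(x, y)` of the plane: the lift of the graph of `y(x)` is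
`(x, y(x), y'(x), …, y^{(k)}(x))`. -/
abbrev Jet (k : ℕ) : Type := ℝ × (Fin (k + 1) → ℝ)

/-- The projection `π_{k,l} : J^k → J^l`; it is linear in the coordinates, so it is
also its own differential. -/
def jetProj {k l : ℕ} (h : l ≤ k) : Jet k →ₗ[ℝ] Jet l :=
  LinearMap.prodMap LinearMap.id (LinearMap.funLeft ℝ ℝ (Fin.castLE (Nat.succ_le_succ h)))

/-- The contact distribution `C^k` at `p ∈ J^k`, spanned by `∂/∂y_k` and
`∂/∂x + y_1 ∂/∂y_0 + … + y_k ∂/∂y_{k-1}`. -/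
def contactDist (k : ℕ) (p : Jet k) : Submodule ℝ (Jet k) :=
  Submodule.span ℝ
    {((0 : ℝ), (Pi.single (Fin.last k) 1 : Fin (k + 1) → ℝ)),
      ((1 : ℝ), fun i : Fin (k + 1) =>
        if h : (i : ℕ) + 1 < k + 1 then p.2 ⟨(i : ℕ) + 1, h⟩ else 0)}

/-- A local contact transformation of `J^k`: a smooth diffeomorphism between two open subsets
whose differential maps the contact distribution onto the contact distribution. -/
structure IsLocalContact {k : ℕ} (φ : OpenPartialHomeomorph (Jet k) (Jet k)) : Prop where
  contDiffOn : ContDiffOn ℝ ∞ φ φ.source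
  contDiffOn_symm : ContDiffOn ℝ ∞ φ.symm φ.target
  map_contactDist : ∀ p ∈ φ.source,
    (contactDist k p).map (fderiv ℝ φ p : Jet k →ₗ[ℝ] Jet k) = contactDist k (φ p)

variable {n : ℕ}

/-- The coordinates `(x, y_0, …, y_n)` parametrize the equation manifold
`y_{n+1} = f(x, y_0, …, y_n)` in `J^{n+1}`; this is the parametrization. -/
def embed (f : Jet n → ℝ) (q : Jet n) : Jet (n + 1) :=
  (q.1, Fin.snoc (α := fun _ => ℝ) q.2 (f q))

/-- The differential at `q` of the parametrization; its range is the tangent space of the equation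
manifold. -/
def dEmbed (f : Jet n → ℝ) (q : Jet n) : Jet n →ₗ[ℝ] Jet (n + 1) :=
  (fderiv ℝ (embed f) q : Jet n →ₗ[ℝ] Jet (n + 1))

/-- The equation manifold `y_{n+1} = f(x, y_0, …, y_n)`, `(x, y_0, …, y_n) ∈ Ω`, in `J^{n+1}`. -/
def equation (Ω : Set (Jet n)) (f : Jet n → ℝ) : Set (Jet (n + 1)) := embed f '' Ω

/-- The line field `E`: the intersection of the tangent space of the equation manifold with the
contact distribution `C^{n+1}`, read in the coordinates `(x, y_0, …, y_n)`. -/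
def lineField (f : Jet n → ℝ) (q : Jet n) : Submodule ℝ (Jet n) :=
  (contactDist (n + 1) (embed f q)).comap (dEmbed f q)

/-- The generator `D = ∂/∂x + y_1 ∂/∂y_0 + … + y_n ∂/∂y_{n-1} + f ∂/∂y_n` of `E`. -/
def totalD (f : Jet n → ℝ) (q : Jet n) : Jet n :=
  (1, fun i => if h : (i : ℕ) + 1 < n + 1 then q.2 ⟨(i : ℕ) + 1, h⟩ else f q)

/-- The filtration of the normal bundle `N = T𝓔 / E`, given by the preimages in `T𝓔` of its
members: `N_i` is the intersection of `π_{n+1,i}^* C^i` with `T𝓔`, modulo `E`. -/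
def normalFiltration (f : Jet n → ℝ) (i : Fin (n + 1)) (q : Jet n) : Submodule ℝ (Jet n) :=
  (contactDist (i : ℕ) (jetProj (Nat.le_succ_of_le (Fin.is_le i)) (embed f q))).comap
    (jetProj (Nat.le_succ_of_le (Fin.is_le i)) ∘ₗ dEmbed f q)

/-!
The representation of `gl(2)` on `V_n`, the binary forms of degree `n` in `v_1, v_2`, as matrices
in the basis `E_j = v_1^(n-j) v_2^j`, `j = 0, …, n`. -/

/-- `X = v_1 ∂/∂v_2`, that is `X E_j = j E_{j-1}`. -/
def opX (n : ℕ) : Matrix (Fin (n + 1)) (Fin (n + 1)) ℝ :=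
  Matrix.of fun i j => if (i : ℕ) + 1 = (j : ℕ) then (j : ℝ) else 0

/-- `Y = v_2 ∂/∂v_1`, that is `Y E_j = (n - j) E_{j+1}`. -/
def opY (n : ℕ) : Matrix (Fin (n + 1)) (Fin (n + 1)) ℝ :=
  Matrix.of fun i j => if (i : ℕ) = (j : ℕ) + 1 then (n : ℝ) - (j : ℝ) else 0

/-- `H = v_1 ∂/∂v_1 - v_2 ∂/∂v_2`, that is `H E_j = (n - 2 j) E_j`. -/
def opH (n : ℕ) : Matrix (Fin (n + 1)) (Fin (n + 1)) ℝ :=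
  Matrix.diagonal fun j => (n : ℝ) - 2 * (j : ℝ)

/-- `Z = v_1 ∂/∂v_1 + v_2 ∂/∂v_2`, that is `Z E_j = n E_j`. -/
def opZ (n : ℕ) : Matrix (Fin (n + 1)) (Fin (n + 1)) ℝ :=
  Matrix.diagonal fun _ => (n : ℝ)

/-- The normal form `-X + α H + β Z + γ Y + ∑_{i=2}^n θ_{i+1} Y^i`. -/
def normalForm (n : ℕ) (α β γ : ℝ) (θ : ℕ → ℝ) : Matrix (Fin (n + 1)) (Fin (n + 1)) ℝ :=
  -opX n + α • opH n + β • opZ n + γ • opY n + ∑ i ∈ Finset.Icc 2 n, θ (i + 1) • opY n ^ i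

/-- Vector fields `S_0, …, S_n` on the open set `U` of the equation manifold that represent a
smooth moving frame `V_n → N`, `E_j ↦ S_j + E`, of the normal bundle which

* respects the filtrations: `span (E_i, …, E_n)` is mapped onto `N_i` for all `i` (for `i = 0` this
  makes it onto `N`, hence an isomorphism as both have dimension `n + 1`), and
* has its partial connection form in normal form: for the partial connection
  `∇_D (S + E) = [D, S] + E` one has `∇_D (S_j + E) = ∑_k A_{kj} (S_k + E)` with
  `A = -X + α H + β Z + γ Y + ∑_{i=2}^n θ_{i+1} Y^i`. -/
structure IsNormalFrame (f : Jet n → ℝ) (U : Set (Jet n)) (S : Fin (n + 1) → Jet n → Jet n)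
    (α β γ : Jet n → ℝ) (θ : ℕ → Jet n → ℝ) : Prop where
  isOpen : IsOpen U
  contDiffOn : ∀ j, ContDiffOn ℝ ∞ (S j) U
  filtration : ∀ q ∈ U, ∀ i : Fin (n + 1),
    Submodule.span ℝ ((fun j => S j q) '' {j | i ≤ j}) ⊔ lineField f q = normalFiltration f i q
  connection : ∀ q ∈ U, ∀ j : Fin (n + 1),
    VectorField.lieBracket ℝ (totalD f) (S j) q
      - ∑ k, normalForm n (α q) (β q) (γ q) (fun i => θ i q) k j • S k q ∈ lineField f q

/-- `t` is the value at `q` of the coefficient `θ_i` of some normal frame near `q`. -/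
def IsWilczynskiValue (f : Jet n → ℝ) (i : ℕ) (q : Jet n) (t : ℝ) : Prop :=
  ∃ (U : Set (Jet n)) (S : Fin (n + 1) → Jet n → Jet n) (α β γ : Jet n → ℝ)
    (θ : ℕ → Jet n → ℝ), q ∈ U ∧ IsNormalFrame f U S α β γ θ ∧ θ i q = t

/-- The function `W_i` on the equation manifold: the common value of the coefficients `θ_i` of the
normal frames near the point. -/
def wilczynskiFun (f : Jet n → ℝ) (i : ℕ) (q : Jet n) : ℝ :=
  Classical.epsilon (IsWilczynskiValue f i q)

/-- The generalized Wilczynski invariant `𝓦_i`, a section of `S^i E^*`, at the point `q`: the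
symmetric `i`-linear form on the line `E_q` with `𝓦_i(D, …, D) = W_i` (note `dx(D) = 1`). -/
def wilczynski (f : Jet n → ℝ) (i : ℕ) (q : Jet n) :
    MultilinearMap ℝ (fun _ : Fin i => lineField f q) ℝ :=
  wilczynskiFun f i q •
    (MultilinearMap.mkPiAlgebra ℝ (Fin i) ℝ).compLinearMap
      (fun _ => LinearMap.fst ℝ ℝ (Fin (n + 1) → ℝ) ∘ₗ (lineField f q).subtype)

end GenWilczynski

end

/-! On an open set `W` of the equation a frame of `N` becomes a matrix over the ring of smooth
functions on `W`. Frames with connection matrices `A` and `B` differ by a `g` with `g * B = A * g +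
D g` (`IsGauge`), and `g` is lower triangular because both respect the filtration. Part (a) thus
becomes algebra over a commutative ring with a derivation, graded by subdiagonals.

All normal forms have leading term `-X`, and everything rests on one fact about `sl(2)`: `ad X` maps
the `(k+1)`-st subdiagonal injectively into the `k`-th, and the lowest weight vector `Y ^ k` spans a
complement of the image (`slice_unique`, `slice_exists`). Hence any connection `-X + (lower
triangular)` can be brought to normal form one subdiagonal at a time
(`exists_isGauge_normalFormOver`). For uniqueness (`coeff_eq_of_isGauge`), diagonal matrices in
geometric progression and `exp (s Y)` have an explicit effect on normal forms. Once they are split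
off, the remaining change of frame is unipotent with vanishing `(1, 0)`-entry, and the same
induction over subdiagonals shows that the `θ i` agree. Replacing `D` by a multiple only produces
the weight `lam ^ i`.

For (b), a contact transformation preserves the preimages of all lower contact distributions, since
each one is generated by brackets of the next (`fderiv_mem_contactFlag`). It therefore induces a
diffeomorphism between open parts of the equations that respects the line fields and the filtrations
and sends `D` to `lam` times the other `D`. A normal frame pulls back to a frame whose connection
along `D` is `lam` times a normal form, so `W_i = lam ^ i * W'_i` (`wilczynskiFun_transform`), which
is the invariance of a section of `S^i E^*`. -/

noncomputable section

namespace GenWilczynski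

/-! ### Matrices graded by subdiagonals. -/

section Algebra

variable {R : Type*} [CommRing R] {n : ℕ}

/-- Square matrices indexed by the basis of the binary forms of degree `n`. -/
abbrev Mat (n : ℕ) (R : Type*) : Type _ := Matrix (Fin (n + 1)) (Fin (n + 1)) R

/-- Matrices whose entries vanish above the `k`-th subdiagonal. -/
def lowerBand (R : Type*) [CommRing R] (n k : ℕ) : Submodule R (Mat n R) where
  carrier := {m | ∀ i j : Fin (n + 1), (i : ℕ) < j + k → m i j = 0}
  add_mem' {a b} ha hb i j h := by simp [ha i j h, hb i j h]
  zero_mem' _ _ _ := rfl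
  smul_mem' c a ha i j h := by simp [ha i j h]

theorem lowerBand_anti {k l : ℕ} (h : k ≤ l) : lowerBand R n l ≤ lowerBand R n k :=
  fun _ hm i j hij => hm i j (by omega)

theorem mul_mem_lowerBand {k l : ℕ} {a b : Mat n R} (ha : a ∈ lowerBand R n k)
    (hb : b ∈ lowerBand R n l) : a * b ∈ lowerBand R n (k + l) := by
  intro i j hij
  rw [Matrix.mul_apply]
  refine Finset.sum_eq_zero fun x _ => ?_
  by_cases hx : (i : ℕ) < x + k
  · rw [ha i x hx, zero_mul]
  · rw [hb x j (by omega), mul_zero]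

theorem one_mem_lowerBand : (1 : Mat n R) ∈ lowerBand R n 0 := by
  intro i j hij
  exact Matrix.one_apply_ne (by rintro rfl; omega)

theorem diagonal_mem_lowerBand (d : Fin (n + 1) → R) : Matrix.diagonal d ∈ lowerBand R n 0 := by
  intro i j hij
  exact Matrix.diagonal_apply_ne _ (by rintro rfl; omega)

theorem eq_zero_of_mem_lowerBand {m : Mat n R} {k : ℕ} (hk : n + 1 ≤ k)
    (hm : m ∈ lowerBand R n k) : m = 0 := by
  ext i j
  exact hm i j (by have := i.2; omega)

/-- The entries of a matrix, extended by zero to all pairs of natural numbers. -/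
def entry (m : Mat n R) (i j : ℕ) : R :=
  if h : i < n + 1 ∧ j < n + 1 then m ⟨i, h.1⟩ ⟨j, h.2⟩ else 0

theorem entry_coe (m : Mat n R) (i j : Fin (n + 1)) : entry m i j = m i j := by
  exact dif_pos ⟨i.2, j.2⟩

theorem entry_of_lt {m : Mat n R} {i j : ℕ} (hi : i < n + 1) (hj : j < n + 1) :
    entry m i j = m ⟨i, hi⟩ ⟨j, hj⟩ := by
  exact dif_pos ⟨hi, hj⟩

theorem entry_of_ge (m : Mat n R) {i j : ℕ} (hi : n + 1 ≤ i) : entry m i j = 0 :=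
  dif_neg (by omega)

theorem entry_add (a b : Mat n R) (i j : ℕ) : entry (a + b) i j = entry a i j + entry b i j := by
  unfold entry; split_ifs <;> simp

theorem entry_sub (a b : Mat n R) (i j : ℕ) : entry (a - b) i j = entry a i j - entry b i j := by
  unfold entry; split_ifs <;> simp

theorem entry_smul (c : R) (a : Mat n R) (i j : ℕ) : entry (c • a) i j = c * entry a i j := by
  unfold entry; split_ifs <;> simp

theorem entry_mem_lowerBand {k : ℕ} {m : Mat n R} (hm : m ∈ lowerBand R n k) {i j : ℕ}
    (h : i < j + k) : entry m i j = 0 := by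
  unfold entry; split_ifs
  · exact hm _ _ h
  · rfl

theorem mem_lowerBand_iff_entry {k : ℕ} {m : Mat n R} :
    m ∈ lowerBand R n k ↔ ∀ i j : ℕ, i < j + k → entry m i j = 0 :=
  ⟨fun hm _ _ h => entry_mem_lowerBand hm h, fun h i j hij => by
    rw [← entry_coe m]; exact h _ _ hij⟩

theorem mem_lowerBand_succ {k : ℕ} {m : Mat n R} (hm : m ∈ lowerBand R n k)
    (h : ∀ j, j + k ≤ n → entry m (j + k) j = 0) : m ∈ lowerBand R n (k + 1) := by
  rw [mem_lowerBand_iff_entry]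
  intro i j hij
  rcases Nat.lt_or_ge i (j + k) with h1 | h1
  · exact entry_mem_lowerBand hm h1
  · obtain rfl : i = j + k := by omega
    rcases Nat.lt_or_ge n (j + k) with h2 | h2
    · exact entry_of_ge _ h2
    · exact h j h2

theorem mul_apply_zero_zero {a b : Mat n R} (hb : b ∈ lowerBand R n 0) (ha : a ∈ lowerBand R n 0)
    (i : Fin (n + 1)) : (a * b) i i = a i i * b i i := by
  rw [Matrix.mul_apply]
  refine Finset.sum_eq_single i (fun x _ hx => ?_) (by simp)
  rcases lt_or_gt_of_ne (Fin.val_ne_of_ne hx) with h | h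
  · rw [hb x i (by omega), mul_zero]
  · rw [ha i x (by omega), zero_mul]

/-! ### Gauge transformations over a ring with a derivation. -/

section Derivation

variable [Algebra ℝ R] (δ : Derivation ℝ R R)

theorem map_derivation_mul (a b : Mat n R) :
    (a * b).map δ = a.map δ * b + a * b.map δ := by
  ext i j
  simp only [Matrix.map_apply, Matrix.mul_apply, Matrix.add_apply, map_sum, Derivation.leibniz,
    smul_eq_mul, ← Finset.sum_add_distrib]
  exact Finset.sum_congr rfl fun x _ => by ring

theorem map_derivation_mem {k : ℕ} {m : Mat n R} (hm : m ∈ lowerBand R n k) :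
    m.map δ ∈ lowerBand R n k := by
  intro i j h
  simp [hm i j h]

/-- `g` transforms the connection matrix `A` of a frame into the connection matrix `B`, where `δ` is
the derivation along the line field. -/
def IsGauge (g A B : Mat n R) : Prop := g * B = A * g + g.map δ

variable {δ}

theorem IsGauge.comp {g k A B C : Mat n R} (hk : IsGauge δ k A B) (hg : IsGauge δ g B C) :
    IsGauge δ (k * g) A C := by
  unfold IsGauge at *
  rw [map_derivation_mul, mul_assoc, hg, mul_add, ← mul_assoc, hk, add_mul, mul_assoc]
  abel

/-- Compares two frames that are both given relative to a third one, the coordinate frame. -/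
theorem IsGauge.of_comp {g k A B C : Mat n R} (hk : IsGauge δ k A B) (hg : IsGauge δ (k * g) A C)
    (hu : IsUnit k) : IsGauge δ g B C := by
  unfold IsGauge at *
  rw [map_derivation_mul, mul_assoc] at hg
  apply hu.mul_left_cancel
  rw [hg, mul_add, ← mul_assoc, ← mul_assoc, hk, add_mul]
  abel

end Derivation

/-! ### The operators of `gl(2)` acting on subdiagonals. -/

section Representation

variable (R n) [Algebra ℝ R]

/-- `opX` with entries in `R`. -/
def matX : Mat n R := (opX n).map (algebraMap ℝ R)

/-- `opY` with entries in `R`. -/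
def matY : Mat n R := (opY n).map (algebraMap ℝ R)

/-- `opH` with entries in `R`. -/
def matH : Mat n R := (opH n).map (algebraMap ℝ R)

/-- `opZ` with entries in `R`. -/
def matZ : Mat n R := (opZ n).map (algebraMap ℝ R)

variable {R}

/-- The normal form with coefficients in `R`. -/
def normalFormOver (α β γ : R) (θ : ℕ → R) : Mat n R :=
  -matX R n + α • matH R n + β • matZ R n + γ • matY R n
    + ∑ i ∈ Finset.Icc 2 n, θ (i + 1) • matY R n ^ i

variable {n}

theorem matX_apply (i j : Fin (n + 1)) :
    matX R n i j = if (i : ℕ) + 1 = j then algebraMap ℝ R (j : ℝ) else 0 := by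
  simp only [matX, opX, Matrix.map_apply, Matrix.of_apply]; split_ifs <;> simp

theorem matY_apply (i j : Fin (n + 1)) :
    matY R n i j = if (i : ℕ) = j + 1 then algebraMap ℝ R (n - (j : ℝ)) else 0 := by
  simp only [matY, opY, Matrix.map_apply, Matrix.of_apply]; split_ifs <;> simp

theorem matH_eq : matH R n =
    Matrix.diagonal fun j : Fin (n + 1) => algebraMap ℝ R ((n : ℝ) - 2 * ((j : ℕ) : ℝ)) := by
  unfold matH opH
  exact Matrix.diagonal_map (map_zero _)

theorem matZ_eq : matZ R n = algebraMap ℝ R (n : ℝ) • (1 : Mat n R) := by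
  ext i j
  by_cases h : i = j <;> simp [matZ, opZ, h]

theorem entry_matX_mul (m : Mat n R) (i j : ℕ) :
    entry (matX R n * m) i j = ((i : ℝ) + 1) • entry m (i + 1) j := by
  by_cases hj : j < n + 1
  swap
  · simp [entry, hj]
  by_cases hi : i + 1 < n + 1
  · rw [entry_of_lt (by omega) hj, entry_of_lt hi hj, Matrix.mul_apply,
      Finset.sum_eq_single ⟨i + 1, hi⟩]
    · simp [matX_apply, Algebra.smul_def]
    · intro x _ hx
      rw [matX_apply, if_neg, zero_mul]
      exact fun h => hx (Fin.ext h.symm)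
    · simp
  · rw [entry_of_ge m (by omega), smul_zero]
    by_cases hi' : i < n + 1
    · rw [entry_of_lt hi' hj, Matrix.mul_apply]
      refine Finset.sum_eq_zero fun x _ => ?_
      rw [matX_apply, if_neg, zero_mul]
      have := x.2
      simp only; omega
    · exact entry_of_ge _ (by omega)

/-- The truncated `j - 1` does no harm: at `j = 0` the factor `j` vanishes. -/
theorem entry_mul_matX (m : Mat n R) (i : ℕ) {j : ℕ} (hj : j ≤ n) :
    entry (m * matX R n) i j = (j : ℝ) • entry m i (j - 1) := by
  by_cases hi : i < n + 1
  swap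
  · simp [entry, hi]
  rw [entry_of_lt hi (by omega), entry_of_lt hi (by omega), Matrix.mul_apply,
    Finset.sum_eq_single ⟨j - 1, by omega⟩]
  · rw [matX_apply]
    rcases Nat.eq_zero_or_pos j with rfl | h
    · simp
    · rw [if_pos (by simp only; omega), Algebra.smul_def]
      exact mul_comm _ _
  · intro x _ hx
    rw [matX_apply, if_neg, mul_zero]
    exact fun h => hx (Fin.ext (by simp only at h ⊢; omega))
  · simp

theorem matY_mem : matY R n ∈ lowerBand R n 1 := by
  intro i j h
  rw [matY_apply, if_neg (by omega)]

theorem matY_pow_mem (k : ℕ) : matY R n ^ k ∈ lowerBand R n k := by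
  induction k with
  | zero => simpa using one_mem_lowerBand
  | succ k ih => exact pow_succ (matY R n) k ▸ mul_mem_lowerBand ih matY_mem

theorem matH_mem : matH R n ∈ lowerBand R n 0 := by
  rw [matH_eq]; exact diagonal_mem_lowerBand _

theorem matZ_mem : matZ R n ∈ lowerBand R n 0 := by
  rw [matZ_eq]; exact Submodule.smul_mem _ _ one_mem_lowerBand

theorem matX_mul_mem {k : ℕ} {m : Mat n R} (hm : m ∈ lowerBand R n (k + 1)) :
    matX R n * m ∈ lowerBand R n k := by
  rw [mem_lowerBand_iff_entry]
  intro i j h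
  rw [entry_matX_mul, entry_mem_lowerBand hm (by omega), smul_zero]

theorem mul_matX_mem {k : ℕ} {m : Mat n R} (hm : m ∈ lowerBand R n (k + 1)) :
    m * matX R n ∈ lowerBand R n k := by
  intro i j h
  rw [← entry_coe (m * matX R n), entry_mul_matX _ _ (by omega)]
  rcases Nat.eq_zero_or_pos (j : ℕ) with h0 | h0
  · simp [h0]
  · rw [entry_mem_lowerBand hm (by omega), smul_zero]

/-- The entries of `Y ^ k` on the `k`-th subdiagonal are positive. -/
theorem exists_entry_matY_pow (k : ℕ) :
    ∃ y : ℕ → ℝ, (∀ j, j + k ≤ n → 0 < y j) ∧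
      ∀ j, j + k ≤ n → entry (matY R n ^ k) (j + k) j = algebraMap ℝ R (y j) := by
  induction k with
  | zero =>
    refine ⟨fun _ => 1, fun _ _ => one_pos, fun j hj => ?_⟩
    rw [pow_zero, entry_of_lt (by omega) (by omega), map_one]
    exact Matrix.one_apply_eq _
  | succ k ih =>
    obtain ⟨y, hy, hY⟩ := ih
    refine ⟨fun j => y (j + 1) * (n - j), fun j hj => mul_pos (hy _ (by omega)) ?_,
      fun j hj => ?_⟩
    · have : ((j + (k + 1) : ℕ) : ℝ) ≤ n := by exact_mod_cast hj
      push_cast at this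
      have : (0 : ℝ) ≤ k := k.cast_nonneg
      linarith
    · rw [pow_succ, entry_of_lt (by omega) (by omega), Matrix.mul_apply,
        Finset.sum_eq_single ⟨j + 1, by omega⟩]
      · rw [matY_apply, if_pos rfl, ← entry_coe (matY R n ^ k)]
        have := hY (j + 1) (by omega)
        rw [map_mul, ← this]
        congr 2
        simp only; omega
      · intro x _ hx
        rw [matY_apply, if_neg, mul_zero]
        exact fun h => hx (Fin.ext h)
      · simp

/-- Along a subdiagonal `ad X` is a two-term recurrence in the column index, which reduces the slice
statements to real linear recurrences. -/
theorem entry_commutator {k : ℕ} (m : Mat n R) {j : ℕ} (hj : j + k ≤ n) :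
    entry (matX R n * m - m * matX R n) (j + k) j =
      ((j : ℝ) + k + 1) • entry m (j + k + 1) j - (j : ℝ) • entry m (j + k) (j - 1) := by
  rw [entry_sub, entry_matX_mul, entry_mul_matX _ _ (by omega)]
  push_cast
  rfl

end Representation

/-! ### Two-term linear recurrences with a boundary condition. -/

section Recurrence

variable {V : Type*} [AddCommGroup V] [Module ℝ V]

/-- Solving upwards from `j = 0` gives every `u j` as a strictly negative real multiple of `c`, so
the boundary value `u N = 0` forces `c = 0`. Positivity is used for the real coefficients only, so
`V` needs no order. -/
theorem recurrence_unique {N k : ℕ} {y : ℕ → ℝ} (hy : ∀ j ≤ N, 0 < y j) {c : V} {u : ℕ → V}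
    (hN : u N = 0)
    (h : ∀ j ≤ N, ((j : ℝ) + k + 1) • u j - (j : ℝ) • u (j - 1) + y j • c = 0) :
    c = 0 ∧ ∀ j ≤ N, u j = 0 := by
  have key : ∀ j ≤ N, ∃ p : ℝ, 0 < p ∧ u j = -(p • c) := by
    intro j
    induction j with
    | zero =>
      intro hj
      refine ⟨(k + 1 : ℝ)⁻¹ * y 0, mul_pos (by positivity) (hy 0 hj), ?_⟩
      have h0 := h 0 hj
      simp only [Nat.cast_zero, zero_add, zero_smul, sub_zero] at h0
      rw [mul_smul, ← smul_neg, ← eq_neg_of_add_eq_zero_left h0, smul_smul,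
        inv_mul_cancel₀ (by positivity), one_smul]
    | succ j ih =>
      intro hj
      obtain ⟨p, hp, hu⟩ := ih (by omega)
      have h0 := h (j + 1) hj
      rw [Nat.add_sub_cancel, hu] at h0
      have hpos : (0 : ℝ) < ((j + 1 : ℕ) : ℝ) + k + 1 := by positivity
      refine ⟨(((j + 1 : ℕ) : ℝ) + k + 1)⁻¹ * (((j + 1 : ℕ) : ℝ) * p + y (j + 1)),
        mul_pos (inv_pos.2 hpos) (add_pos (by positivity) (hy _ hj)), ?_⟩
      have h1 : (((j + 1 : ℕ) : ℝ) + k + 1) • u (j + 1)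
          = -((((j + 1 : ℕ) : ℝ) * p + y (j + 1)) • c) := by
        rw [eq_neg_iff_add_eq_zero, ← h0]
        module
      rw [mul_smul, ← smul_neg, ← h1, smul_smul, inv_mul_cancel₀ hpos.ne', one_smul]
  obtain ⟨p, hp, hu⟩ := key N le_rfl
  have hc : c = 0 := by
    rw [hN, eq_comm, neg_eq_zero, smul_eq_zero] at hu
    exact hu.resolve_left hp.ne'
  refine ⟨hc, fun j hj => ?_⟩
  obtain ⟨q, _, hq⟩ := key j hj
  rw [hq, hc, smul_zero, neg_zero]

theorem exists_recurrence (k : ℕ) (e : ℕ → V) :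
    ∃ u : ℕ → V, ∀ j : ℕ, ((j : ℝ) + k + 1) • u j - (j : ℝ) • u (j - 1) + e j = 0 := by
  refine ⟨fun j => Nat.rec (-((k + 1 : ℝ)⁻¹ • e 0))
    (fun j w => (((j + 1 : ℕ) : ℝ) + k + 1)⁻¹ • (((j + 1 : ℕ) : ℝ) • w - e (j + 1))) j, ?_⟩
  rintro (_ | j)
  · change (((0 : ℕ) : ℝ) + k + 1) • (-((k + 1 : ℝ)⁻¹ • e 0)) - _ + e 0 = 0
    simp only [Nat.cast_zero, zero_add, zero_smul, sub_zero, smul_neg, smul_smul]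
    rw [mul_inv_cancel₀ (by positivity), one_smul, neg_add_cancel]
  · have hpos : (0 : ℝ) < ((j + 1 : ℕ) : ℝ) + k + 1 := by positivity
    simp only [Nat.add_sub_cancel, smul_smul]
    rw [mul_inv_cancel₀ hpos.ne', one_smul]
    abel

/-- Superposition: `u` solves the recurrence with source `e`, `w` the one with source `y`, and `c =
-u N / w N` makes the sum vanish at `N`. Here `w N ≠ 0` by `recurrence_unique` with `c = 1`. -/
theorem exists_recurrence_vanishing {N : ℕ} (k : ℕ) {y : ℕ → ℝ} (hy : ∀ j ≤ N, 0 < y j)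
    (e : ℕ → V) :
    ∃ (c : V) (u : ℕ → V), u N = 0 ∧
      ∀ j : ℕ, ((j : ℝ) + k + 1) • u j - (j : ℝ) • u (j - 1) + y j • c + e j = 0 := by
  obtain ⟨u, hu⟩ := exists_recurrence k e
  obtain ⟨w, hw⟩ := exists_recurrence k y
  have hwN : w N ≠ 0 := by
    intro h
    have := (recurrence_unique (c := (1 : ℝ)) hy h fun j _ => by simpa using hw j).1
    exact one_ne_zero this
  refine ⟨-((w N)⁻¹ • u N), fun j => u j + w j • (-((w N)⁻¹ • u N)), ?_, fun j => ?_⟩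
  · simp [smul_smul, hwN]
  · have h1 : (((j : ℝ) + k + 1) • w j - (j : ℝ) • w (j - 1) + y j) • (-((w N)⁻¹ • u N)) = 0 := by
      rw [hw j, zero_smul]
    rw [← add_zero (0 : V)]
    nth_rw 1 [← hu j]
    rw [← h1]
    generalize -((w N)⁻¹ • u N) = c
    simp only [smul_eq_mul]
    module

end Recurrence

/-! ### The powers of `Y` as a slice transversal to the image of `ad X`. -/

section Slice

variable [Algebra ℝ R]

theorem opX_mul_opY_sub : opX n * opY n - opY n * opX n = opH n := by
  ext i j
  have hX : opX n = matX ℝ n := by ext; simp [matX]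
  have hYe : opY n = matY ℝ n := by ext; simp [matY]
  rw [Matrix.sub_apply, hX, ← entry_coe (matX ℝ n * opY n), ← entry_coe (opY n * matX ℝ n),
    entry_matX_mul, entry_mul_matX _ _ (by omega)]
  have hent : ∀ a b : ℕ, b < n + 1 → entry (opY n) a b = if a = b + 1 then (n : ℝ) - b else 0 := by
    intro a b hb
    by_cases ha : a < n + 1
    · rw [entry_of_lt ha hb]; rfl
    · rw [entry_of_ge _ (by omega)]
      split_ifs with h
      · obtain rfl : b = n := by omega
        simp
      · rfl
  have hi := i.2
  have hj := j.2
  rw [hent _ _ hj, hent _ _ (by omega)]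
  simp only [opH, Matrix.diagonal_apply, Fin.ext_iff, smul_eq_mul]
  by_cases h : (i : ℕ) = j
  · rw [if_pos (by omega), if_pos h, h]
    rcases Nat.eq_zero_or_pos (j : ℕ) with h0 | h0
    · simp [h0]
    · rw [if_pos (by omega), Nat.cast_sub (by omega)]
      push_cast
      ring
  · rw [if_neg (by omega), if_neg h]
    rcases Nat.eq_zero_or_pos (j : ℕ) with h0 | h0
    · simp [h0]
    · rw [if_neg (by omega)]
      simp

theorem opH_mul_opY_sub : opH n * opY n - opY n * opH n = (-2 : ℝ) • opY n := by
  ext i j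
  simp only [opH, opY, Matrix.sub_apply, Matrix.diagonal_mul, Matrix.mul_diagonal, Matrix.of_apply,
    Matrix.smul_apply, smul_eq_mul]
  split_ifs with h
  · rw [h]; push_cast; ring
  · simp

theorem matX_mul_matY_sub :
    matX R n * matY R n - matY R n * matX R n = matH R n := by
  have := congrArg ((algebraMap ℝ R).mapMatrix) (opX_mul_opY_sub (n := n))
  rw [map_sub, map_mul, map_mul] at this
  exact this

theorem matH_mul_matY_sub :
    matH R n * matY R n - matY R n * matH R n = (-2 : ℝ) • matY R n := by
  have := congrArg ((Algebra.ofId ℝ R).mapMatrix) (opH_mul_opY_sub (n := n))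
  rw [map_smul, map_sub, map_mul, map_mul] at this
  exact this

/-- In positive degree the powers of `Y` are transversal to the image of `ad X`, and `ad X` is
injective. -/
theorem slice_unique {k : ℕ} (hk : k ≤ n) {m : Mat n R} {c : R}
    (hm : m ∈ lowerBand R n (k + 1))
    (h : matX R n * m - m * matX R n + c • matY R n ^ k ∈ lowerBand R n (k + 1)) :
    c = 0 ∧ m ∈ lowerBand R n (k + 2) := by
  obtain ⟨y, hy, hY⟩ := exists_entry_matY_pow (R := R) (n := n) k
  -- The `(k+1)`-st subdiagonal ends at column `n - k - 1`. The entry at `j = n - k` is outside the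
  -- matrix and hence zero, which is the boundary condition.
  have := recurrence_unique (N := n - k) (k := k) (y := y) (c := c)
    (u := fun j => entry m (j + k + 1) j) (fun j hj => hy j (by omega))
    (entry_of_ge _ (by omega)) fun j hj => by
      have h1 := entry_mem_lowerBand h (i := j + k) (j := j) (by omega)
      rw [entry_add, entry_commutator (R := R) m (by omega), entry_smul, hY j (by omega)] at h1
      rw [← h1, Algebra.smul_def (y j), mul_comm c]
      congr 2
      rcases Nat.eq_zero_or_pos j with rfl | hj0
      · simp
      · congr 2
        omega
  refine ⟨this.1, mem_lowerBand_succ hm fun j hj => ?_⟩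
  exact this.2 j (by omega)

/-- Together the powers of `Y` and the image of `ad X` span. -/
theorem slice_exists {k : ℕ} (hk : k ≤ n) {e : Mat n R} (he : e ∈ lowerBand R n k) :
    ∃ (c : R) (m : Mat n R), m ∈ lowerBand R n (k + 1) ∧
      e + (matX R n * m - m * matX R n) + c • matY R n ^ k ∈ lowerBand R n (k + 1) := by
  obtain ⟨y, hy, hY⟩ := exists_entry_matY_pow (R := R) (n := n) k
  obtain ⟨c, u, huN, hu⟩ := exists_recurrence_vanishing (N := n - k) k (y := y)
    (fun j hj => hy j (by omega)) fun j => entry e (j + k) j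
  -- The solution is written along the `(k+1)`-st subdiagonal; `u (n - k) = 0` is what lets it fit
  -- into the matrix.
  set m : Mat n R := Matrix.of fun i j => if (i : ℕ) = j + k + 1 then u j else 0 with hm
  have hmem : m ∈ lowerBand R n (k + 1) := fun i j hij => by
    rw [hm, Matrix.of_apply, if_neg (by omega)]
  have hent : ∀ j, j + k ≤ n → entry m (j + k + 1) j = u j := by
    intro j hj
    rcases Nat.lt_or_ge (j + k) n with h | h
    · rw [entry_of_lt (by omega) (by omega)]
      simp [hm]
    · rw [entry_of_ge _ (by omega), ← huN]
      congr 1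
      omega
  refine ⟨c, m, hmem, mem_lowerBand_succ ?_ fun j hj => ?_⟩
  · exact add_mem (add_mem he (sub_mem (matX_mul_mem hmem) (mul_matX_mem hmem)))
      (Submodule.smul_mem _ _ (matY_pow_mem k))
  · rw [entry_add, entry_add, entry_commutator m hj, entry_smul, hY j hj, hent j hj, ← hu j,
      Algebra.smul_def (y j), mul_comm c]
    have : (j : ℝ) • entry m (j + k) (j - 1) = (j : ℝ) • u (j - 1) := by
      rcases Nat.eq_zero_or_pos j with rfl | hj0
      · simp
      · rw [← hent (j - 1) (by omega)]
        congr 2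
        omega
    rw [this]
    abel

/-- The degree-zero part of the uniqueness, where `H` and `Z` are admitted. -/
theorem slice_zero_unique (hn : 1 ≤ n) {m : Mat n R} {a b : R} (hm : m ∈ lowerBand R n 1)
    (h0 : entry m 1 0 = 0)
    (h : matX R n * m - m * matX R n + a • matH R n + b • matZ R n ∈ lowerBand R n 1) :
    a = 0 ∧ b = 0 ∧ m ∈ lowerBand R n 2 := by
  have hn' : (0 : ℝ) < n := by exact_mod_cast hn
  -- Since `H = [X, Y]`, the term in `H` is absorbed by replacing `m` with `m + a • Y`, and `Z = n •
  -- Y ^ 0`. The `(1, 0)`-entry of `Y` is `n`, so `h0` then gives `a = 0`.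
  have hY1 : m + a • matY R n ∈ lowerBand R n (0 + 1) :=
    add_mem hm (Submodule.smul_mem _ _ matY_mem)
  have h1 := slice_unique (k := 0) (c := (n : ℝ) • b) (Nat.zero_le n) hY1 (by
    convert h using 1
    rw [← matX_mul_matY_sub, matZ_eq, pow_zero, mul_add, add_mul, Algebra.smul_def (n : ℝ) b, smul_smul,
      mul_comm b, mul_smul_comm, smul_mul_assoc, smul_sub]
    abel)
  have hb : b = 0 := (smul_eq_zero.1 h1.1).resolve_left hn'.ne'
  have ha : a = 0 := by
    have h2 := entry_mem_lowerBand h1.2 (i := 1) (j := 0) (by omega)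
    rw [entry_add, h0, entry_smul, entry_of_lt (by omega) (by omega), matY_apply,
      if_pos (by simp), zero_add, mul_comm, ← Algebra.smul_def] at h2
    exact (smul_eq_zero.1 h2).resolve_left (by simpa using hn'.ne')
  refine ⟨ha, hb, ?_⟩
  simpa [ha] using h1.2

end Slice

end Algebra

/-! ### Gauge equivalence of normal forms: residual freedom, uniqueness, existence. -/

section NormalForms

variable {R : Type*} [CommRing R] [Algebra ℝ R] {n : ℕ}

theorem matY_pow_mul_matH (k : ℕ) :
    matY R n ^ k * matH R n = matH R n * matY R n ^ k + (2 * k : ℝ) • matY R n ^ k := by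
  induction k with
  | zero => simp
  | succ k ih =>
    have h : matY R n * matH R n = matH R n * matY R n + (2 : ℝ) • matY R n := by
      have := matH_mul_matY_sub (R := R) (n := n)
      rw [sub_eq_iff_eq_add] at this
      rw [this]
      module
    rw [pow_succ, mul_assoc, h, mul_add, ← mul_assoc, ih, add_mul, mul_assoc, mul_smul_comm,
      smul_mul_assoc, ← pow_succ]
    push_cast
    module

theorem matX_mul_matY_pow (k : ℕ) :
    matX R n * matY R n ^ (k + 1) = matY R n ^ (k + 1) * matX R n
      + (k + 1 : ℝ) • (matH R n * matY R n ^ k) + ((k + 1) * k : ℝ) • matY R n ^ k := by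
  have h : matX R n * matY R n = matY R n * matX R n + matH R n := by
    rw [← matX_mul_matY_sub]; abel
  induction k with
  | zero => simp [h]
  | succ k ih =>
    have h2 : matX R n * matY R n ^ (k + 1) * matY R n = matY R n ^ (k + 1) * (matX R n * matY R n)
        + (k + 1 : ℝ) • (matH R n * (matY R n ^ k * matY R n))
        + ((k + 1) * k : ℝ) • (matY R n ^ k * matY R n) := by
      rw [ih]
      simp only [add_mul, smul_mul_assoc, mul_assoc]
    rw [pow_succ, ← mul_assoc, h2, h, mul_add, matY_pow_mul_matH, ← pow_succ, ← mul_assoc,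
      ← pow_succ]
    push_cast
    module

/-- The partial sums of `exp (s Y)`. -/
def expSum (n : ℕ) (s : R) (N : ℕ) : Mat n R :=
  ∑ k ∈ Finset.range N, ((k.factorial : ℝ)⁻¹ • s ^ k) • matY R n ^ k

theorem expSum_succ (s : R) (N : ℕ) :
    expSum n s (N + 1) = expSum n s N + ((N.factorial : ℝ)⁻¹ • s ^ N) • matY R n ^ N :=
  Finset.sum_range_succ _ _

theorem smul_expCoeff (s : R) (k : ℕ) :
    (k + 1 : ℝ) • (((k + 1).factorial : ℝ)⁻¹ • s ^ (k + 1)) = s * ((k.factorial : ℝ)⁻¹ • s ^ k) := by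
  rw [smul_smul, Nat.factorial_succ, pow_succ', mul_smul_comm]
  congr 1
  have : ((k.factorial : ℕ) : ℝ) ≠ 0 := by positivity
  push_cast
  field_simp

/-- Truncation of `exp (s Y) H = (H + 2 s Y) exp (s Y)`. Taking partial sums of different lengths
makes it exact for every `N`; nilpotency of `Y` later identifies the lengths. -/
theorem expSum_mul_matH (s : R) (N : ℕ) :
    expSum n s (N + 1) * matH R n =
      matH R n * expSum n s (N + 1) + (2 * s) • (matY R n * expSum n s N) := by
  induction N with
  | zero => simp [expSum]
  | succ N ih =>
    have hb := smul_expCoeff s N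
    rw [expSum_succ, add_mul, ih, smul_mul_assoc, matY_pow_mul_matH, expSum_succ s N]
    simp only [mul_add, mul_smul_comm, ← pow_succ']
    generalize (N.factorial : ℝ)⁻¹ • s ^ N = a at *
    generalize ((N + 1).factorial : ℝ)⁻¹ • s ^ (N + 1) = b at *
    have key : b • (2 * ((N + 1 : ℕ) : ℝ)) • matY R n ^ (N + 1) = (2 * (s * a)) • matY R n ^ (N + 1) := by
      rw [smul_comm, ← smul_assoc, mul_smul, Nat.cast_succ, hb, two_smul, two_mul]
    rw [smul_add b, key]
    module

/-- Truncation of `exp (s Y) X = (X - s H - s ^ 2 Y) exp (s Y)`. -/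
theorem expSum_mul_matX (s : R) (N : ℕ) :
    expSum n s (N + 2) * matX R n = matX R n * expSum n s (N + 2)
      - s • (matH R n * expSum n s (N + 1)) - (s ^ 2) • (matY R n * expSum n s N) := by
  induction N with
  | zero =>
    have := matX_mul_matY_pow (R := R) (n := n) 0
    simp only [expSum, Finset.sum_range_succ, Finset.sum_range_zero, pow_zero, pow_one, mul_one,
      one_mul, zero_add, add_mul, mul_add, Nat.cast_zero, mul_zero, zero_smul, add_zero,
      smul_mul_assoc, mul_smul_comm] at this ⊢
    simp [this]
    abel
  | succ N ih =>
    have h : matY R n ^ (N + 2) * matX R n = matX R n * matY R n ^ (N + 2)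
        - (((N + 1 : ℕ) : ℝ) + 1) • (matH R n * matY R n ^ (N + 1))
        - ((((N + 1 : ℕ) : ℝ) + 1) * ((N + 1 : ℕ) : ℝ)) • matY R n ^ (N + 1) := by
      rw [matX_mul_matY_pow (N + 1)]
      abel
    have c1 := smul_expCoeff s (N + 1)
    have c2 := smul_expCoeff s N
    rw [expSum_succ, add_mul, ih, smul_mul_assoc, h, expSum_succ s (N + 1), expSum_succ s N]
    simp only [mul_add, mul_smul_comm, ← pow_succ']
    generalize (N.factorial : ℝ)⁻¹ • s ^ N = a at *
    generalize ((N + 1).factorial : ℝ)⁻¹ • s ^ (N + 1) = b at *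
    generalize ((N + 1 + 1).factorial : ℝ)⁻¹ • s ^ (N + 1 + 1) = c at *
    have k1 : c • (((N + 1 : ℕ) : ℝ) + 1) • (matH R n * matY R n ^ (N + 1))
        = (s * b) • (matH R n * matY R n ^ (N + 1)) := by
      rw [smul_comm, ← smul_assoc, c1]
    have k2 : c • ((((N + 1 : ℕ) : ℝ) + 1) * ((N + 1 : ℕ) : ℝ)) • matY R n ^ (N + 1)
        = (s * (s * a)) • matY R n ^ (N + 1) := by
      rw [smul_comm, ← smul_assoc, mul_comm, mul_smul, c1, ← mul_smul_comm, Nat.cast_succ, c2]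
    rw [smul_sub c, smul_sub c, k1, k2]
    module

theorem map_derivation_expSum (δ : Derivation ℝ R R) (s : R) (N : ℕ) :
    (expSum n s (N + 1)).map δ = δ s • (matY R n * expSum n s N) := by
  induction N with
  | zero =>
    ext i j
    by_cases h : i = j <;> simp [expSum, h]
  | succ N ih =>
    have hY : ∀ k, (matY R n ^ k).map δ = 0 := by
      intro k
      ext i j
      have : matY R n ^ k = (opY n ^ k).map (algebraMap ℝ R) :=
        (map_pow (algebraMap ℝ R).mapMatrix (opY n) k).symm
      rw [this]
      simp
    have hs : ∀ (c : R) (m : Mat n R), (c • m).map δ = δ c • m + c • m.map δ := by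
      intro c m
      ext i j
      simp [mul_comm, add_comm]
    rw [expSum_succ, Matrix.map_add _ (map_add δ), ih, hs, hY, smul_zero, add_zero,
      expSum_succ s N, mul_add, smul_add, mul_smul_comm, ← pow_succ', smul_smul,
      Derivation.map_smul, Derivation.leibniz_pow, Nat.add_sub_cancel]
    congr 2
    rw [mul_smul_comm, smul_eq_mul, ← Nat.cast_smul_eq_nsmul ℝ, smul_smul, mul_comm (δ s),
      Nat.factorial_succ]
    have : ((N.factorial : ℕ) : ℝ) ≠ 0 := by positivity
    congr 1
    push_cast
    field_simp

theorem expSum_stable (s : R) {N : ℕ} (hN : n + 1 ≤ N) : expSum n s (N + 1) = expSum n s N := by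
  rw [expSum_succ, eq_zero_of_mem_lowerBand hN (matY_pow_mem N), smul_zero, add_zero]

theorem commute_expSum (s : R) (N : ℕ) : Commute (expSum n s N) (matY R n) :=
  Commute.sum_left _ _ _ fun k _ => ((Commute.refl _).pow_left k).smul_left _

/-- The change of frame by `exp (s Y)`. -/
theorem isGauge_expSum (δ : Derivation ℝ R R) (s α β γ : R) (θ : ℕ → R) :
    IsGauge δ (expSum n s (n + 1))
      (normalFormOver n (α + s) β (γ + s ^ 2 + 2 * s * α - δ s) θ) (normalFormOver n α β γ θ) := by
  have hP1 : expSum n s (n + 2) = expSum n s (n + 1) := expSum_stable s le_rfl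
  have hP2 : expSum n s (n + 3) = expSum n s (n + 1) := by
    rw [← hP1]; exact expSum_stable s (by omega)
  have hX := expSum_mul_matX (n := n) s (n + 1)
  have hH := expSum_mul_matH (n := n) s (n + 1)
  have hδ := map_derivation_expSum (n := n) δ s (n + 1)
  rw [hP2, hP1] at hX
  rw [hP1] at hH hδ
  have hY := (commute_expSum (n := n) s (n + 1)).eq
  have hsum : expSum n s (n + 1) * ∑ i ∈ Finset.Icc 2 n, θ (i + 1) • matY R n ^ i
      = (∑ i ∈ Finset.Icc 2 n, θ (i + 1) • matY R n ^ i) * expSum n s (n + 1) :=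
    (Commute.sum_right _ _ _ fun i _ =>
      ((commute_expSum s (n + 1)).pow_right i).smul_right _).eq
  unfold IsGauge normalFormOver
  simp only [mul_add, add_mul, hsum, mul_neg, neg_mul, mul_smul_comm, smul_mul_assoc, hX, hH, hδ,
    hY, matZ_eq, mul_one, one_mul]
  module

theorem expSum_sub_one_mem (s : R) (N : ℕ) : expSum n s (N + 1) - 1 ∈ lowerBand R n 1 := by
  unfold expSum
  rw [Finset.sum_range_succ']
  simp only [Nat.factorial_zero, Nat.cast_one, inv_one, pow_zero, one_smul, add_sub_cancel_right]
  exact Submodule.sum_mem _ fun k _ =>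
    Submodule.smul_mem _ _ (lowerBand_anti (by omega) (matY_pow_mem (k + 1)))

/-- Shows that a suitable `s` cancels any prescribed `(1, 0)`-entry of a unipotent matrix. -/
theorem entry_expSum (hn : 1 ≤ n) (s : R) (N : ℕ) :
    entry (expSum n s (N + 2)) 1 0 = (n : ℝ) • s := by
  have hmem : expSum n s (N + 2) - 1 - s • matY R n ∈ lowerBand R n 2 := by
    unfold expSum
    rw [Finset.sum_range_succ', Finset.sum_range_succ']
    simp only [Nat.factorial_zero, Nat.cast_one, inv_one, pow_zero, one_smul, add_sub_cancel_right,
      zero_add, pow_one, Nat.factorial_one]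
    exact Submodule.sum_mem _ fun k _ =>
      Submodule.smul_mem _ _ (lowerBand_anti (by omega) (matY_pow_mem _))
  have h := entry_mem_lowerBand hmem (i := 1) (j := 0) (by omega)
  rw [entry_sub, entry_sub, entry_smul, sub_sub, sub_eq_zero] at h
  rw [h, entry_of_lt (by omega) (by omega), entry_of_lt (by omega) (by omega),
    Matrix.one_apply_ne (by simp), matY_apply, if_pos (by simp), zero_add, Algebra.smul_def,
    mul_comm]
  simp

variable {δ : Derivation ℝ R R}

/-- The normal form as a perturbation of `-X`, with all powers of `Y` collected. -/
theorem normalFormOver_eq (hn : 1 ≤ n) (α β γ : R) (θ : ℕ → R) :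
    normalFormOver n α β γ θ = -matX R n + α • matH R n + β • matZ R n
      + ∑ i ∈ Finset.Icc 1 n, (if i = 1 then γ else θ (i + 1)) • matY R n ^ i := by
  have h : Finset.Icc 1 n = insert 1 (Finset.Icc 2 n) := by
    ext i; simp only [Finset.mem_insert, Finset.mem_Icc]; omega
  rw [h, Finset.sum_insert (by simp), if_pos rfl, pow_one, normalFormOver, add_assoc _ (γ • _)]
  congr 2
  refine Finset.sum_congr rfl fun i hi => ?_
  rw [if_neg]
  have := (Finset.mem_Icc.1 hi).1
  omega

theorem normalFormOver_add_matX_mem (α β γ : R) (θ : ℕ → R) :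
    normalFormOver n α β γ θ + matX R n ∈ lowerBand R n 0 := by
  have : normalFormOver n α β γ θ + matX R n = α • matH R n + β • matZ R n + γ • matY R n
    + ∑ i ∈ Finset.Icc 2 n, θ (i + 1) • matY R n ^ i := by
    unfold normalFormOver; abel
  rw [this]
  exact add_mem (add_mem (add_mem (Submodule.smul_mem _ _ matH_mem)
    (Submodule.smul_mem _ _ matZ_mem))
    (Submodule.smul_mem _ _ (lowerBand_anti (Nat.zero_le 1) matY_mem)))
    (Submodule.sum_mem _ fun i _ =>
      Submodule.smul_mem _ _ (lowerBand_anti (Nat.zero_le i) (matY_pow_mem i)))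

/-- A unipotent change of frame between normal forms whose `(1, 0)`-entry vanishes does not change
the coefficients. -/
theorem coeff_eq_of_unipotent (hn : 1 ≤ n) {m : Mat n R} {α β γ α' β' γ' : R} {θ θ' : ℕ → R}
    (hm : m - 1 ∈ lowerBand R n 1) (h10 : entry (m - 1) 1 0 = 0)
    (h : IsGauge δ m (normalFormOver n α β γ θ) (normalFormOver n α' β' γ' θ')) :
    ∀ i ∈ Finset.Icc 3 (n + 1), θ i = θ' i := by
  set A := normalFormOver n α β γ θ with hA
  set A' := normalFormOver n α' β' γ' θ' with hA'
  set M := m - 1 with hM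
  have hAX := normalFormOver_add_matX_mem (n := n) α β γ θ
  have hAX' := normalFormOver_add_matX_mem (n := n) α' β' γ' θ'
  rw [← hA] at hAX
  rw [← hA'] at hAX'
  have hδ : m.map δ = M.map δ := by
    ext i j
    by_cases h : i = j <;> simp [hM, h]
  -- With `m = 1 + M` the gauge equation isolates `ad X M + (A' - A)`. What is left on the right
  -- lies in every band that contains `M`, one better than `ad X M` alone, and this drives the
  -- induction.
  have key : matX R n * M - M * matX R n + (A' - A) =
      -(M * (A' + matX R n) - (A + matX R n) * M - M.map δ) := by
    have h1 : m * A' = A * m + M.map δ := hδ ▸ h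
    have h2 : m = M + 1 := by rw [hM]; abel
    rw [h2, add_mul, mul_add, one_mul, mul_one] at h1
    rw [eq_neg_iff_add_eq_zero, mul_add, add_mul, ← sub_eq_zero.2 h1]
    abel
  have hband : ∀ k, M ∈ lowerBand R n k →
      matX R n * M - M * matX R n + (A' - A) ∈ lowerBand R n k := by
    intro k hk
    rw [key]
    refine neg_mem (sub_mem (sub_mem ?_ ?_) (map_derivation_mem δ hk))
    · exact mul_mem_lowerBand hk hAX'
    · simpa using mul_mem_lowerBand hAX hk
  set d : ℕ → R := fun i => (if i = 1 then γ' else θ' (i + 1)) - (if i = 1 then γ else θ (i + 1))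
    with hd
  have hdiff : A' - A = (α' - α) • matH R n + (β' - β) • matZ R n
      + ∑ i ∈ Finset.Icc 1 n, d i • matY R n ^ i := by
    rw [hA, hA', normalFormOver_eq hn, normalFormOver_eq hn]
    simp only [hd, sub_smul, Finset.sum_sub_distrib]
    abel
  obtain ⟨ha, hb, hM2⟩ := slice_zero_unique hn (a := α' - α) (b := β' - β) hm h10 (by
    have h1 := hband 1 hm
    rw [hdiff, ← add_assoc, ← add_assoc] at h1
    refine (Submodule.add_mem_iff_left _ (Submodule.sum_mem _ fun i hi => ?_)).1 h1
    exact Submodule.smul_mem _ _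
      (lowerBand_anti (Finset.mem_Icc.1 hi).1 (matY_pow_mem i)))
  rw [ha, hb, zero_smul, zero_smul, zero_add, zero_add] at hdiff
  -- Modulo band `k + 2` only the coefficient of `Y ^ (k + 1)` survives in `A' - A`. By
  -- `slice_unique` it vanishes and `M` drops by one more band.
  have step : ∀ k ≤ n, M ∈ lowerBand R n (k + 2) ∧ ∀ i, 1 ≤ i → i ≤ k → d i = 0 := by
    intro k
    induction k with
    | zero => exact fun _ => ⟨hM2, fun i h1 h2 => by omega⟩
    | succ k ih =>
      intro hk
      obtain ⟨h1, h2⟩ := ih (by omega)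
      have h3 := hband _ h1
      have hmem : k + 1 ∈ Finset.Icc 1 n := Finset.mem_Icc.2 ⟨by omega, hk⟩
      rw [hdiff, ← Finset.add_sum_erase _ _ hmem, ← add_assoc] at h3
      have h4 := (Submodule.add_mem_iff_left _ (Submodule.sum_mem _ fun i hi => ?_)).1 h3
      · obtain ⟨h5, h6⟩ := slice_unique hk h1 h4
        refine ⟨h6, fun i hi1 hi2 => ?_⟩
        rcases Nat.lt_or_ge i (k + 1) with hlt | hge
        · exact h2 i hi1 (by omega)
        · obtain rfl : i = k + 1 := by omega
          exact h5
      · obtain ⟨hne, hi'⟩ := Finset.mem_erase.1 hi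
        obtain ⟨hi1, hi2⟩ := Finset.mem_Icc.1 hi'
        rcases Nat.lt_or_ge i (k + 1) with hlt | hge
        · rw [h2 i hi1 (by omega), zero_smul]
          exact zero_mem _
        · exact Submodule.smul_mem _ _ (lowerBand_anti (by omega) (matY_pow_mem i))
  intro i hi
  obtain ⟨hi1, hi2⟩ := Finset.mem_Icc.1 hi
  have := (step n le_rfl).2 (i - 1) (by omega) (by omega)
  simp only [hd] at this
  rw [if_neg (by omega), if_neg (by omega), Nat.sub_add_cancel (by omega), sub_eq_zero] at this
  exact this.symm

/-- Above the diagonal both connections equal `-X`, so `X m - m X` is lower triangular. Its entry at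
`(j, j + 1)` is `j + 1` times the difference of consecutive diagonal entries of `m`, so the diagonal
is constant. -/
theorem sub_one_mem_of_isGauge {m : Mat n R} {A B : Mat n R} (hA : A + matX R n ∈ lowerBand R n 0)
    (hB : B + matX R n ∈ lowerBand R n 0) (hm : m ∈ lowerBand R n 0) (h0 : m 0 0 = 1)
    (h : IsGauge δ m A B) : m - 1 ∈ lowerBand R n 1 := by
  have key : matX R n * m - m * matX R n ∈ lowerBand R n 0 := by
    have : matX R n * m - m * matX R n = (A + matX R n) * m - m * (B + matX R n) + m.map δ := by
      unfold IsGauge at h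
      rw [add_mul, mul_add, h]
      abel
    rw [this]
    exact add_mem (sub_mem (mul_mem_lowerBand hA hm) (mul_mem_lowerBand hm hB))
      (map_derivation_mem δ hm)
  have hdiag : ∀ j, j ≤ n → entry m j j = 1 := by
    intro j
    induction j with
    | zero =>
      intro _
      rw [entry_of_lt (by omega) (by omega)]
      exact h0
    | succ j ih =>
      intro hj
      have h1 := entry_mem_lowerBand key (i := j) (j := j + 1) (by omega)
      rw [entry_sub, entry_matX_mul, entry_mul_matX _ _ hj, Nat.add_sub_cancel, ih (by omega)] at h1
      push_cast at h1
      rw [← smul_sub, smul_eq_zero, sub_eq_zero] at h1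
      exact h1.resolve_left (by positivity)
  refine mem_lowerBand_succ (sub_mem hm one_mem_lowerBand) fun j hj => ?_
  rw [entry_sub, add_zero, hdiag j (by omega), entry_of_lt (by omega) (by omega),
    Matrix.one_apply_eq, sub_self]

/-- The change of frame by a diagonal matrix with entries in geometric progression. -/
theorem isGauge_diagonal (hn : 1 ≤ n) (δ : Derivation ℝ R R) {κ μ ν lam : R} (hμ : κ * μ = 1)
    (hν : ν * lam = 1) (α β γ : R) (θ : ℕ → R) :
    ∃ a b c, IsGauge (ν • δ) (Matrix.diagonal fun j : Fin (n + 1) => κ * ν ^ (j : ℕ))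
      (normalFormOver n a b c fun i => ν ^ i * θ i) (ν • normalFormOver n α β γ θ) := by
  set k : Mat n R := Matrix.diagonal fun j : Fin (n + 1) => κ * ν ^ (j : ℕ) with hk
  -- Conjugation undoes the factor `ν` on `-X` and multiplies `Y ^ i` by `ν ^ i`, so that `ν * θ (i
  -- + 1)` turns into `ν ^ (i + 1) * θ (i + 1)`.
  have hXk : ν • (k * matX R n) = matX R n * k := by
    ext i j
    rw [hk, Matrix.smul_apply, Matrix.diagonal_mul, Matrix.mul_diagonal, matX_apply]
    split_ifs with h
    · rw [← h, smul_eq_mul]; ring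
    · simp
  have hYk : k * matY R n = ν • (matY R n * k) := by
    ext i j
    rw [hk, Matrix.smul_apply, Matrix.diagonal_mul, Matrix.mul_diagonal, matY_apply]
    split_ifs with h
    · rw [h, smul_eq_mul]; ring
    · simp
  have hYpow : ∀ i, k * matY R n ^ i = ν ^ i • (matY R n ^ i * k) := by
    intro i
    induction i with
    | zero => simp
    | succ i ih =>
      rw [pow_succ, ← mul_assoc, ih, smul_mul_assoc, mul_assoc, hYk, mul_smul_comm, smul_smul,
        mul_assoc, pow_succ]
  have hHk : k * matH R n = matH R n * k := by
    rw [hk, matH_eq, Matrix.diagonal_mul_diagonal, Matrix.diagonal_mul_diagonal]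
    congr 1
    ext
    exact mul_comm _ _
  set δ' := ν • δ with hδ'
  set p := μ * δ' κ with hp
  set q := lam * δ' ν with hq
  -- The logarithmic derivative of the `j`-th diagonal entry is `p + j q`. It is affine in `j`,
  -- hence a combination of `H` and `Z`, and changes only `α` and `β`.
  have hδk : ((2 : ℝ)⁻¹ • q) • (matH R n * k)
      + (-((n : ℝ)⁻¹ • p) - (2 : ℝ)⁻¹ • q) • (algebraMap ℝ R (n : ℝ) • k) + k.map δ' = 0 := by
    have hn' : (n : ℝ) ≠ 0 := by positivity
    ext i j
    by_cases h : i = j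
    swap
    · simp [hk, matH_eq, Matrix.diagonal_apply_ne _ h]
    subst h
    have hpow : δ' (ν ^ (i : ℕ)) = ((i : ℕ) : ℝ) • (q * ν ^ (i : ℕ)) := by
      rw [Derivation.leibniz_pow, ← Nat.cast_smul_eq_nsmul ℝ]
      rcases Nat.eq_zero_or_pos (i : ℕ) with h0 | h0
      · simp [h0]
      · congr 1
        obtain ⟨l, hl⟩ := Nat.exists_eq_add_of_le' h0
        rw [hl, Nat.add_sub_cancel, smul_eq_mul, hq, pow_succ]
        linear_combination (-(ν ^ l * δ' ν)) * hν
    have hκ : δ' κ = p * κ := by rw [hp]; linear_combination (-(δ' κ)) * hμ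
    simp only [hk, matH_eq, Matrix.add_apply, Matrix.smul_apply, Matrix.diagonal_mul_diagonal,
      Matrix.diagonal_apply_eq, Matrix.map_apply, Derivation.leibniz, smul_eq_mul, hpow, hκ,
      Matrix.zero_apply, ← Algebra.smul_def]
    have e1 : algebraMap ℝ R n * algebraMap ℝ R (n : ℝ)⁻¹ = 1 := by
      rw [← map_mul, mul_inv_cancel₀ hn', map_one]
    have e2 : algebraMap ℝ R 2 * algebraMap ℝ R 2⁻¹ = 1 := by
      rw [← map_mul, mul_inv_cancel₀ two_ne_zero, map_one]
    simp only [Algebra.smul_def, map_sub, map_mul]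
    linear_combination (-(q * algebraMap ℝ R ((i : ℕ) : ℝ) * (κ * ν ^ (i : ℕ)))) * e2
      - p * (κ * ν ^ (i : ℕ)) * e1
  refine ⟨ν * α + (2 : ℝ)⁻¹ • q, ν * β + (-((n : ℝ)⁻¹ • p) - (2 : ℝ)⁻¹ • q), ν ^ 2 * γ, ?_⟩
  have hsum : k * ∑ i ∈ Finset.Icc 2 n, (ν * θ (i + 1)) • matY R n ^ i
      = (∑ i ∈ Finset.Icc 2 n, (ν ^ (i + 1) * θ (i + 1)) • matY R n ^ i) * k := by
    rw [Finset.mul_sum, Finset.sum_mul]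
    refine Finset.sum_congr rfl fun i _ => ?_
    rw [mul_smul_comm, hYpow, smul_smul, smul_mul_assoc]
    congr 1
    ring
  unfold IsGauge normalFormOver
  simp only [smul_add, Finset.smul_sum, smul_smul, mul_add, add_mul, hsum, mul_neg, neg_mul,
    mul_smul_comm, smul_mul_assoc, smul_neg, hXk, hHk, hYk, matZ_eq, mul_one, one_mul]
  rw [← sub_eq_zero, ← neg_eq_zero, ← hδk]
  module

/-- Two normal forms that are related by a change of frame, up to the factor `lam`, have the same
coefficients `θ i` up to powers of `lam`. -/
theorem coeff_eq_of_isGauge (hn : 1 ≤ n) {g : Mat n R} {α β γ α' β' γ' lam : R} {θ θ' : ℕ → R}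
    (hlam : IsUnit lam) (hg : g ∈ lowerBand R n 0) (hg0 : IsUnit (g 0 0))
    (h : IsGauge δ g (normalFormOver n α β γ θ) (lam • normalFormOver n α' β' γ' θ')) :
    ∀ i ∈ Finset.Icc 3 (n + 1), θ i = lam ^ i * θ' i := by
  obtain ⟨ν, hν⟩ := hlam.exists_left_inv
  obtain ⟨κ, hκ⟩ := hg0.exists_left_inv
  -- Dividing by `lam` amounts to differentiating along `ν • δ` with `ν = lam⁻¹`.
  have h1 : IsGauge (ν • δ) g (ν • normalFormOver n α β γ θ) (normalFormOver n α' β' γ' θ') := by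
    unfold IsGauge at h ⊢
    have h2 := congrArg (ν • ·) h
    simp only [mul_smul_comm, smul_smul, hν, one_smul, smul_add] at h2
    rw [h2, smul_mul_assoc]
    rfl
  obtain ⟨a, b, c, h2⟩ := isGauge_diagonal hn δ hκ hν α β γ θ
  have h3 := h2.comp h1
  set m := (Matrix.diagonal fun j : Fin (n + 1) => κ * ν ^ (j : ℕ)) * g with hm
  have hm1 : m - 1 ∈ lowerBand R n 1 := by
    refine sub_one_mem_of_isGauge (normalFormOver_add_matX_mem _ _ _ _)
      (normalFormOver_add_matX_mem _ _ _ _) ?_ ?_ h3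
    · exact mul_mem_lowerBand (diagonal_mem_lowerBand _) hg
    · rw [hm, Matrix.diagonal_mul]
      simpa using hκ
  have hn' : (n : ℝ) ≠ 0 := by positivity
  -- By `entry_expSum` this `s` cancels the `(1, 0)`-entry, as `coeff_eq_of_unipotent` requires.
  set s : R := -((n : ℝ)⁻¹ • entry (m - 1) 1 0) with hs
  have h4 := (isGauge_expSum (n := n) (ν • δ) s a b c fun i => ν ^ i * θ i).comp h3
  have hexp := expSum_sub_one_mem (n := n) s n
  have hsplit : expSum n s (n + 1) * m - 1 =
      (expSum n s (n + 1) - 1) * (m - 1) + (expSum n s (n + 1) - 1) + (m - 1) := by noncomm_ring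
  have h5 := coeff_eq_of_unipotent hn (by
      rw [hsplit]
      exact add_mem (add_mem (lowerBand_anti (by omega) (mul_mem_lowerBand hexp hm1)) hexp) hm1) (by
      rw [hsplit, entry_add, entry_add, entry_sub (expSum n s (n + 1)),
        entry_mem_lowerBand (mul_mem_lowerBand hexp hm1) (by omega),
        ← expSum_stable s le_rfl, entry_expSum hn, entry_of_lt (m := 1) (by omega) (by omega),
        Matrix.one_apply_ne (by simp), hs, smul_neg, smul_smul, mul_inv_cancel₀ hn', one_smul]
      ring) h4
  intro i hi
  rw [← h5 i hi, ← mul_assoc, ← mul_pow, mul_comm lam, hν, one_pow, one_mul]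

/-- Every connection matrix of the form `-X + (lower triangular)` is unipotently equivalent to a
normal form. -/
theorem exists_isGauge_normalFormOver (hn : 1 ≤ n) {A : Mat n R}
    (hA : A + matX R n ∈ lowerBand R n 0) :
    ∃ (g : Mat n R) (β γ : R) (θ : ℕ → R), g - 1 ∈ lowerBand R n 1 ∧
      IsGauge δ g A (normalFormOver n 0 β γ θ) := by
  -- Induction on the band of the error: `slice_exists` removes its `k`-th subdiagonal by adding `u`
  -- to `g` and `c • Y ^ k` to the target. All side effects lie in band `k + 1`, and band `n + 1` is
  -- zero.
  have key : ∀ k ≤ n + 1, ∃ (g : Mat n R) (τ : ℕ → R), g - 1 ∈ lowerBand R n 1 ∧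
      g * (-matX R n + ∑ i ∈ Finset.range k, τ i • matY R n ^ i) - A * g - g.map δ
        ∈ lowerBand R n k := by
    intro k
    induction k with
    | zero =>
      intro _
      refine ⟨1, 0, by simp, ?_⟩
      have : (1 : Mat n R).map δ = 0 := by
        ext i j
        by_cases h : i = j <;> simp [h]
      rw [this, Finset.sum_range_zero, add_zero, one_mul, mul_one, sub_zero]
      convert neg_mem hA using 1
      abel
    | succ k ih =>
      intro hk
      obtain ⟨g, τ, hg, he⟩ := ih (by omega)
      obtain ⟨c, u, hu, hc⟩ := slice_exists (by omega) he
      refine ⟨g + u, Function.update τ k c, ?_, ?_⟩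
      · rw [add_sub_right_comm]
        exact add_mem hg (lowerBand_anti (by omega) hu)
      have hsum : ∑ i ∈ Finset.range (k + 1), Function.update τ k c i • matY R n ^ i
          = (∑ i ∈ Finset.range k, τ i • matY R n ^ i) + c • matY R n ^ k := by
        rw [Finset.sum_range_succ, Function.update_self]
        congr 1
        refine Finset.sum_congr rfl fun i hi => ?_
        rw [Function.update_of_ne]
        exact (Finset.mem_range.1 hi).ne
      rw [hsum]
      have hS : ∑ i ∈ Finset.range k, τ i • matY R n ^ i ∈ lowerBand R n 0 :=
        Submodule.sum_mem _ fun i _ =>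
          Submodule.smul_mem _ _ (lowerBand_anti (Nat.zero_le i) (matY_pow_mem i))
      set S := ∑ i ∈ Finset.range k, τ i • matY R n ^ i
      have hcY : c • matY R n ^ k ∈ lowerBand R n k := Submodule.smul_mem _ _ (matY_pow_mem k)
      have hsplit : (g + u) * (-matX R n + (S + c • matY R n ^ k)) - A * (g + u) - (g + u).map δ
          = (g * (-matX R n + S) - A * g - g.map δ + (matX R n * u - u * matX R n)
              + c • matY R n ^ k)
            + ((g - 1) * (c • matY R n ^ k) + u * S + u * (c • matY R n ^ k)
              - (A + matX R n) * u - u.map δ) := by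
        rw [Matrix.map_add _ (map_add δ)]
        generalize c • matY R n ^ k = T
        noncomm_ring
      rw [hsplit]
      refine add_mem hc (sub_mem (sub_mem (add_mem (add_mem ?_ ?_) ?_) ?_) ?_)
      · exact lowerBand_anti (by omega) (mul_mem_lowerBand hg hcY)
      · exact lowerBand_anti (l := k + 1 + 0) le_rfl (mul_mem_lowerBand hu hS)
      · exact lowerBand_anti (by omega) (mul_mem_lowerBand hu hcY)
      · exact lowerBand_anti (by omega) (mul_mem_lowerBand hA hu)
      · exact map_derivation_mem δ hu
  obtain ⟨g, τ, hg, he⟩ := key (n + 1) le_rfl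
  have h0 := eq_zero_of_mem_lowerBand le_rfl he
  have hn' : (n : ℝ) ≠ 0 := by positivity
  -- `τ i` is the coefficient of `Y ^ i`: `τ 0` becomes `β` because `Z = n • 1`, and the shift
  -- reflects that `θ (i + 1)` multiplies `Y ^ i`.
  refine ⟨g, (n : ℝ)⁻¹ • τ 0, τ 1, fun i => τ (i - 1), hg, ?_⟩
  have hr : Finset.range (n + 1) = insert 0 (Finset.Icc 1 n) := by
    ext i; simp only [Finset.mem_insert, Finset.mem_Icc, Finset.mem_range]; omega
  have hnf : normalFormOver n 0 ((n : ℝ)⁻¹ • τ 0) (τ 1) (fun i => τ (i - 1))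
      = -matX R n + ∑ i ∈ Finset.range (n + 1), τ i • matY R n ^ i := by
    rw [normalFormOver_eq hn, hr, Finset.sum_insert (by simp), pow_zero, zero_smul, add_zero,
      matZ_eq, smul_smul, mul_comm, ← Algebra.smul_def, smul_smul, mul_inv_cancel₀ hn', one_smul,
      add_assoc]
    congr 2
    refine Finset.sum_congr rfl fun i _ => ?_
    split_ifs with h
    · rw [h]
    · rfl
  unfold IsGauge
  rw [hnf, ← sub_eq_zero, ← h0]
  abel

end NormalForms

/-! ### The algebra of smooth functions on a set, and its derivations when the set is open. -/

section SmoothFunctions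


variable {E : Type*} {W : Set E}

/-- The extension by zero of a function on a subset. -/
def extendZero (u : W → ℝ) : E → ℝ := Function.extend Subtype.val u 0

theorem extendZero_coe (u : W → ℝ) (q : W) : extendZero u q = u q :=
  Subtype.val_injective.extend_apply _ _ _

theorem extendZero_eqOn {u : W → ℝ} {v : E → ℝ} (h : ∀ q : W, u q = v q) :
    Set.EqOn (extendZero u) v W := fun q hq => (extendZero_coe u ⟨q, hq⟩).trans (h ⟨q, hq⟩)

variable [NormedAddCommGroup E] [NormedSpace ℝ E]

theorem contDiffOn_extendZero_iff {u : W → ℝ} {v : E → ℝ} (h : ∀ q : W, u q = v q) :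
    ContDiffOn ℝ ∞ (extendZero u) W ↔ ContDiffOn ℝ ∞ v W :=
  contDiffOn_congr (extendZero_eqOn h)

variable (W) in
/-- The algebra of smooth functions on `W`. -/
def smoothOn : Subalgebra ℝ (W → ℝ) where
  carrier := {u | ContDiffOn ℝ ∞ (extendZero u) W}
  mul_mem' {u v} hu hv := (contDiffOn_extendZero_iff (v := extendZero u * extendZero v)
    fun q => by simp [extendZero_coe]).2 (hu.mul hv)
  add_mem' {u v} hu hv := (contDiffOn_extendZero_iff (v := extendZero u + extendZero v)
    fun q => by simp [extendZero_coe]).2 (hu.add hv)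
  algebraMap_mem' c := (contDiffOn_extendZero_iff (v := fun _ => c)
    fun q => by simp).2 contDiffOn_const

/-- The restriction to `W` of a function that is smooth on `W`. -/
def smoothOn.mk {v : E → ℝ} (hv : ContDiffOn ℝ ∞ v W) : smoothOn W :=
  ⟨fun q => v q, (contDiffOn_extendZero_iff fun _ => rfl).2 hv⟩

theorem smoothOn.mk_apply {v : E → ℝ} (hv : ContDiffOn ℝ ∞ v W) (q : W) :
    (smoothOn.mk hv).1 q = v q := rfl

/-- A representative of an element of `smoothOn W` on the whole space. -/
def smoothOn.repr (u : smoothOn W) : E → ℝ := extendZero u.1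

theorem smoothOn.contDiffOn (u : smoothOn W) : ContDiffOn ℝ ∞ (smoothOn.repr u) W := u.2

theorem smoothOn.repr_coe (u : smoothOn W) (q : W) : (smoothOn.repr u) q = u.1 q := extendZero_coe _ _

/-- Evaluation at a point. -/
def smoothOn.eval (q : W) : smoothOn W →ₐ[ℝ] ℝ :=
  (Pi.evalAlgHom ℝ (fun _ : W => ℝ) q).comp (smoothOn W).val

theorem smoothOn.eval_apply (q : W) (u : smoothOn W) : smoothOn.eval q u = u.1 q := rfl

theorem smoothOn.ext_eval {u v : smoothOn W} (h : ∀ q, smoothOn.eval q u = smoothOn.eval q v) :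
    u = v := Subtype.ext (funext h)

theorem smoothOn.matrix_ext {n : ℕ} {a b : Mat n (smoothOn W)}
    (h : ∀ q, a.map (smoothOn.eval q) = b.map (smoothOn.eval q)) : a = b := by
  refine Matrix.ext fun i j => ?_
  exact smoothOn.ext_eval fun q => congrFun (congrFun (h q) i) j

theorem smoothOn.isUnit {u : smoothOn W} (h : ∀ q : W, u.1 q ≠ 0) : IsUnit u := by
  have hinv : ContDiffOn ℝ ∞ (fun q => ((smoothOn.repr u) q)⁻¹) W :=
    (smoothOn.contDiffOn u).inv fun q hq => by
      have := h ⟨q, hq⟩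
      rwa [← smoothOn.repr_coe u] at this
  refine IsUnit.of_mul_eq_one (smoothOn.mk hinv) (smoothOn.ext_eval fun q => ?_)
  rw [map_mul, map_one, smoothOn.eval_apply, smoothOn.eval_apply, smoothOn.mk_apply,
    smoothOn.repr_coe]
  exact mul_inv_cancel₀ (h q)

/-- `fderiv` depends only on the germ, so on an open `W` the extension by zero may be exchanged for
any function with the same values on `W`. -/
theorem smoothOn.repr_eventuallyEq (hW : IsOpen W) {u : smoothOn W} {v : E → ℝ} (q : W)
    (h : ∀ q : W, u.1 q = v q) : (smoothOn.repr u) =ᶠ[nhds (q : E)] v :=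
  (extendZero_eqOn h).eventuallyEq_of_mem (hW.mem_nhds q.2)

/-- The derivation of the algebra of smooth functions given by a vector field. -/
def alongField (hW : IsOpen W) {X : E → E} (hX : ContDiffOn ℝ ∞ X W) :
    Derivation ℝ (smoothOn W) (smoothOn W) := by
  have hdiff : ∀ (u : smoothOn W) (q : W), DifferentiableAt ℝ (smoothOn.repr u) q := fun u q =>
    ((smoothOn.contDiffOn u).contDiffAt (hW.mem_nhds q.2)).differentiableAt (by simp)
  have hsm : ∀ u : smoothOn W, ContDiffOn ℝ ∞ (fun q => fderiv ℝ (smoothOn.repr u) q (X q)) W := fun u =>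
    ((smoothOn.contDiffOn u).fderiv_of_isOpen hW (by simp)).clm_apply hX
  refine Derivation.mk' (R := ℝ)
    { toFun := fun u => smoothOn.mk (hsm u)
      map_add' := fun u v => smoothOn.ext_eval fun q => ?_
      map_smul' := fun c u => smoothOn.ext_eval fun q => ?_ } fun u v =>
      smoothOn.ext_eval fun q => ?_
  · rw [map_add]
    simp only [smoothOn.eval_apply, smoothOn.mk_apply]
    have : (smoothOn.repr (u + v)) =ᶠ[nhds (q : E)] (smoothOn.repr u) + (smoothOn.repr v) :=
      smoothOn.repr_eventuallyEq hW q fun p => by simp [smoothOn.repr_coe]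
    rw [this.fderiv_eq, fderiv_add (hdiff u q) (hdiff v q)]
    rfl
  · rw [map_smul]
    simp only [smoothOn.eval_apply, smoothOn.mk_apply, RingHom.id_apply]
    have : (smoothOn.repr (c • u)) =ᶠ[nhds (q : E)] c • (smoothOn.repr u) :=
      smoothOn.repr_eventuallyEq hW q fun p => by simp [smoothOn.repr_coe]
    rw [this.fderiv_eq, fderiv_const_smul (hdiff u q)]
    rfl
  · simp only [LinearMap.coe_mk, AddHom.coe_mk, smul_eq_mul, map_add, map_mul]
    simp only [smoothOn.eval_apply, smoothOn.mk_apply]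
    have : (smoothOn.repr (u * v)) =ᶠ[nhds (q : E)] (smoothOn.repr u) * (smoothOn.repr v) :=
      smoothOn.repr_eventuallyEq hW q fun p => by simp [smoothOn.repr_coe]
    rw [this.fderiv_eq, fderiv_mul (hdiff u q) (hdiff v q)]
    simp [smoothOn.repr_coe]

theorem eval_alongField (hW : IsOpen W) {X : E → E} (hX : ContDiffOn ℝ ∞ X W) (u : smoothOn W)
    (q : W) : smoothOn.eval q (alongField hW hX u) = fderiv ℝ (smoothOn.repr u) q (X q) := rfl

end SmoothFunctions

/-! ### The line field, the filtration and the partial connection in coordinates. -/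

section Coordinates

variable {n : ℕ}

theorem mem_contactDist {k : ℕ} {p v : Jet k} :
    v ∈ contactDist k p ↔ ∀ (i : Fin (k + 1)) (h : (i : ℕ) + 1 < k + 1),
      v.2 i = v.1 * p.2 ⟨(i : ℕ) + 1, h⟩ := by
  rw [contactDist, Submodule.mem_span_pair]
  constructor
  · rintro ⟨a, b, rfl⟩ i h
    have hi : i ≠ Fin.last k := by
      rintro rfl
      simp at h
    have h' := Nat.lt_of_succ_lt_succ h
    simp [h', hi]
  · intro h
    refine ⟨v.2 (Fin.last k), v.1, Prod.ext (by simp) (funext fun i => ?_)⟩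
    by_cases hi : i = Fin.last k
    · subst hi
      simp
    · have h' : (i : ℕ) < k := by
        have := Fin.val_ne_of_ne hi
        have := i.2
        simp only [Fin.val_last] at *
        omega
      simp [h', hi, h i (Nat.succ_lt_succ h')]

/-- The coordinates modulo `D` of a tangent vector of the equation manifold. -/
def normalCoord (f : Jet n → ℝ) (q : Jet n) : Jet n →ₗ[ℝ] (Fin (n + 1) → ℝ) :=
  LinearMap.snd ℝ ℝ _ - (LinearMap.fst ℝ ℝ _).smulRight (totalD f q).2

theorem normalCoord_apply (f : Jet n → ℝ) (q v : Jet n) :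
    normalCoord f q v = v.2 - v.1 • (totalD f q).2 := rfl

/-- With `f` read as `y_{n+1}`, the components of `D` are the shifted coordinates of the point in
`J^{n+1}`, so the last component needs no separate treatment. -/
theorem totalD_snd (f : Jet n → ℝ) (q : Jet n) (i : Fin (n + 1)) :
    (totalD f q).2 i = (embed f q).2 i.succ := by
  simp only [totalD, embed, Fin.snoc, Fin.val_succ, cast_eq]
  split_ifs <;> rfl

theorem hasFDerivAt_embed {f : Jet n → ℝ} {q : Jet n} (hf : DifferentiableAt ℝ f q) :
    HasFDerivAt (embed f) ((ContinuousLinearMap.fst ℝ ℝ _).prod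
      (ContinuousLinearMap.pi fun i : Fin (n + 2) =>
        Fin.lastCases (motive := fun _ => Jet n →L[ℝ] ℝ) (fderiv ℝ f q)
        (fun j => (ContinuousLinearMap.proj j).comp (ContinuousLinearMap.snd ℝ ℝ _)) i)) q := by
  refine hasFDerivAt_fst.prodMk (hasFDerivAt_pi.2 fun i => ?_)
  refine Fin.lastCases ?_ (fun j => ?_) i
  · simp only [Fin.lastCases_last, Fin.snoc_last]
    exact hf.hasFDerivAt
  · simp only [Fin.lastCases_castSucc, Fin.snoc_castSucc]
    exact hasFDerivAt_pi'.1 hasFDerivAt_snd j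

theorem dEmbed_apply {f : Jet n → ℝ} {q : Jet n} (hf : DifferentiableAt ℝ f q) (v : Jet n) :
    dEmbed f q v = (v.1, Fin.snoc (α := fun _ => ℝ) v.2 (fderiv ℝ f q v)) := by
  rw [dEmbed, (hasFDerivAt_embed hf).fderiv]
  refine Prod.ext rfl (funext fun i => ?_)
  refine Fin.lastCases ?_ (fun j => ?_) i <;> simp

theorem mem_lineField {f : Jet n → ℝ} {q : Jet n} (hf : DifferentiableAt ℝ f q) {v : Jet n} :
    v ∈ lineField f q ↔ normalCoord f q v = 0 := by
  rw [lineField, Submodule.mem_comap, mem_contactDist, dEmbed_apply hf, funext_iff]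
  constructor
  · intro h i
    have := h i.castSucc (by simp; omega)
    simp only [Fin.snoc_castSucc] at this
    rw [normalCoord_apply, Pi.sub_apply, Pi.smul_apply, totalD_snd, this, Pi.zero_apply,
      smul_eq_mul, sub_eq_zero]
    rfl
  · intro h i hi
    obtain ⟨j, rfl⟩ : ∃ j : Fin (n + 1), i = j.castSucc :=
      ⟨⟨i, by omega⟩, rfl⟩
    have := h j
    rw [normalCoord_apply, Pi.sub_apply, Pi.smul_apply, totalD_snd, Pi.zero_apply, smul_eq_mul,
      sub_eq_zero] at this
    simp only [Fin.snoc_castSucc]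
    exact this

theorem mem_normalFiltration {f : Jet n → ℝ} {q : Jet n} (hf : DifferentiableAt ℝ f q)
    {i : Fin (n + 1)} {v : Jet n} :
    v ∈ normalFiltration f i q ↔ ∀ j < i, normalCoord f q v j = 0 := by
  rw [normalFiltration, Submodule.mem_comap, mem_contactDist]
  simp only [LinearMap.comp_apply, dEmbed_apply hf]
  have key : ∀ (j : Fin (n + 1)), (Fin.snoc (α := fun _ => ℝ) v.2 (fderiv ℝ f q v) j.castSucc
      = v.1 * (embed f q).2 j.succ) ↔ normalCoord f q v j = 0 := by
    intro j
    rw [normalCoord_apply, Pi.sub_apply, Pi.smul_apply, totalD_snd, smul_eq_mul, sub_eq_zero,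
      Fin.snoc_castSucc]
  constructor
  · intro h j hj
    rw [← key]
    exact h ⟨j, by have := Fin.lt_def.1 hj; omega⟩ (by have := Fin.lt_def.1 hj; simp only; omega)
  · intro h j hj
    have := (key ⟨j, by have := i.2; omega⟩).2 (h _ (Fin.lt_def.2 (by simp only; omega)))
    exact this

theorem lineField_le_normalFiltration {f : Jet n → ℝ} {q : Jet n} (hf : DifferentiableAt ℝ f q)
    (i : Fin (n + 1)) : lineField f q ≤ normalFiltration f i q := fun v hv =>
  (mem_normalFiltration hf).2 fun j _ => by rw [(mem_lineField hf).1 hv]; rfl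

theorem contDiffOn_totalD {f : Jet n → ℝ} {W : Set (Jet n)} (hf : ContDiffOn ℝ ∞ f W) :
    ContDiffOn ℝ ∞ (totalD f) W := by
  refine contDiffOn_const.prodMk (contDiffOn_pi.2 fun i => ?_)
  split_ifs with h
  · exact ((contDiff_apply ℝ ℝ _).comp contDiff_snd).contDiffOn
  · exact hf

/-- The matrix of the partial connection in the frame `∂/∂y_0, …, ∂/∂y_n`. -/
def coordConnection (f : Jet n → ℝ) (q : Jet n) : Mat n ℝ :=
  Matrix.of fun k i => -(fderiv ℝ (totalD f) q (0, Pi.single i 1)).2 k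

/-- Write `S = S.1 • D + (0, w)`. The part along `D` contributes only multiples of `D` to the
bracket, and the `x`-component of `D` is constant, so modulo `D` there remain `D w` and the
zeroth-order term `coordConnection`. -/
theorem normalCoord_lieBracket {f : Jet n → ℝ} {q : Jet n} (hf : DifferentiableAt ℝ (totalD f) q)
    {S : Jet n → Jet n} (hS : DifferentiableAt ℝ S q) (k : Fin (n + 1)) :
    normalCoord f q (VectorField.lieBracket ℝ (totalD f) S q) k =
      (coordConnection f q).mulVec (normalCoord f q (S q)) k
        + fderiv ℝ (fun p => normalCoord f p (S p) k) q (totalD f q) := by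
  set L := fderiv ℝ (totalD f) q with hL
  have hL1 : ∀ v, (L v).1 = 0 := by
    intro v
    have h1 : HasFDerivAt (fun p => (totalD f p).1)
      ((ContinuousLinearMap.fst ℝ ℝ _).comp L) q := hf.hasFDerivAt.fst
    have h2 : HasFDerivAt (fun p => (totalD f p).1) (0 : Jet n →L[ℝ] ℝ) q :=
      hasFDerivAt_const (1 : ℝ) q
    exact DFunLike.congr_fun (h1.unique h2) v
  have hcoord : (coordConnection f q).mulVec (normalCoord f q (S q)) k
      = -(L (0, normalCoord f q (S q))).2 k := by
    set w := normalCoord f q (S q)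
    have hw : ((0 : ℝ), w) = ∑ i, w i • ((0 : ℝ), (Pi.single i 1 : Fin (n + 1) → ℝ)) := by
      refine Prod.ext (by simp [Prod.fst_sum]) ?_
      rw [Prod.snd_sum]
      simp only [Prod.smul_snd]
      exact pi_eq_sum_univ' w
    rw [hw, map_sum, Prod.snd_sum, Finset.sum_apply, Matrix.mulVec, dotProduct,
      ← Finset.sum_neg_distrib]
    refine Finset.sum_congr rfl fun i _ => ?_
    rw [map_smul]
    simp [coordConnection, hL, mul_comm]
  have hsplit : S q = (S q).1 • totalD f q + ((0 : ℝ), normalCoord f q (S q)) := by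
    refine Prod.ext ?_ ?_
    · simp [totalD]
    · simp [normalCoord_apply]
  have hLS : (L (S q)).2 k = (S q).1 * (L (totalD f q)).2 k
      + (L (0, normalCoord f q (S q))).2 k := by
    conv_lhs => rw [hsplit, map_add, map_smul]
    rfl
  have hd : HasFDerivAt (fun p => normalCoord f p (S p) k) _ q :=
    (hasFDerivAt_pi'.1 hS.hasFDerivAt.snd k).sub
      (hS.hasFDerivAt.fst.mul (hasFDerivAt_pi'.1 hf.hasFDerivAt.snd k))
  rw [hd.fderiv, hcoord, VectorField.lieBracket_eq]
  simp only [normalCoord_apply, Pi.sub_apply, Prod.snd_sub, Prod.fst_sub, Pi.smul_apply,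
    smul_eq_mul, ← hL, hL1, hLS]
  simp
  ring

end Coordinates

/-! ### Reading the coefficients of a normal form off its entries. -/

section Entries

variable {R : Type*} [CommRing R] {n : ℕ}

theorem entry_sum {ι : Type*} (s : Finset ι) (m : ι → Mat n R) (i j : ℕ) :
    entry (∑ x ∈ s, m x) i j = ∑ x ∈ s, entry (m x) i j := by
  unfold entry
  split_ifs
  · exact Matrix.sum_apply _ _ _ _
  · simp

theorem map_entry {S : Type*} [CommRing S] (e : R →+* S) (m : Mat n R) (i j : ℕ) :
    e (entry m i j) = entry (m.map e) i j := by
  unfold entry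
  split_ifs <;> simp

/-- A lower triangular matrix with invertible diagonal has a lower triangular inverse. -/
theorem exists_inverse_lowerBand {b : Mat n R} (hb : b ∈ lowerBand R n 0)
    (hu : ∀ i, IsUnit (b i i)) : ∃ c ∈ lowerBand R n 0, b * c = 1 ∧ c * b = 1 := by
  have hbt : b.BlockTriangular OrderDual.toDual := fun i j hij => hb i j (by simpa using hij)
  have hdet : IsUnit b.det := by
    rw [Matrix.det_of_isLowerTriangular b hbt]
    exact (IsUnit.prod_univ_iff).2 hu
  let := Matrix.invertibleOfIsUnitDet b hdet
  refine ⟨b⁻¹, fun i j hij => ?_, b.mul_nonsing_inv hdet, b.nonsing_inv_mul hdet⟩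
  exact Matrix.blockTriangular_inv_of_blockTriangular hbt (by simpa using hij)

variable [Algebra ℝ R]

theorem matY_pow_apply_ne {k : ℕ} {i j : Fin (n + 1)} (h : (i : ℕ) ≠ j + k) :
    (matY R n ^ k) i j = 0 := by
  induction k generalizing j with
  | zero =>
    rw [pow_zero]
    exact Matrix.one_apply_ne fun hij => h (by rw [hij, add_zero])
  | succ k ih =>
    rw [pow_succ, Matrix.mul_apply]
    refine Finset.sum_eq_zero fun x _ => ?_
    by_cases hx : (x : ℕ) = j + 1
    · rw [ih (by omega), zero_mul]
    · rw [matY_apply, if_neg hx, mul_zero]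

/-- Two diagonal entries determine `α` and `β`. -/
theorem entry_normalFormOver_diag (hn : 1 ≤ n) (α β γ : R) (θ : ℕ → R) {j : ℕ} (hj : j ≤ n) :
    entry (normalFormOver n α β γ θ) j j = ((n : ℝ) - 2 * j) • α + (n : ℝ) • β := by
  have h0 : ∀ i ∈ Finset.Icc 1 n,
      entry ((if i = 1 then γ else θ (i + 1)) • matY R n ^ i) j j = 0 := by
    intro i hi
    rw [entry_smul, entry_mem_lowerBand (matY_pow_mem i) (by
      have := (Finset.mem_Icc.1 hi).1
      omega), mul_zero]
  have hX : entry (-matX R n) j j = 0 := by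
    rw [entry_of_lt (by omega) (by omega), Matrix.neg_apply, matX_apply, if_neg (by simp), neg_zero]
  rw [normalFormOver_eq hn, entry_add, entry_add, entry_add, entry_sum, Finset.sum_eq_zero h0, hX,
    entry_smul, entry_smul, matH_eq, matZ_eq, entry_smul,
    entry_of_lt (m := Matrix.diagonal _) (by omega) (by omega),
    entry_of_lt (m := 1) (by omega) (by omega), Matrix.diagonal_apply_eq, Matrix.one_apply_eq,
    Algebra.smul_def, Algebra.smul_def]
  ring

/-- Each power of `Y` meets the first column in its own row, so this column determines `γ` and the
`θ i`. -/
theorem entry_normalFormOver_col (hn : 1 ≤ n) (α β γ : R) (θ : ℕ → R) {i : ℕ} (hi : 1 ≤ i)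
    (hin : i ≤ n) : entry (normalFormOver n α β γ θ) i 0
      = (if i = 1 then γ else θ (i + 1)) * entry (matY R n ^ i) i 0 := by
  have hX : entry (-matX R n) i 0 = 0 := by
    rw [entry_of_lt (by omega) (by omega), Matrix.neg_apply, matX_apply, if_neg (by simp), neg_zero]
  have hH : entry (matH R n) i 0 = 0 := by
    rw [entry_of_lt (by omega) (by omega), matH_eq, Matrix.diagonal_apply_ne]
    simpa using Nat.ne_of_gt hi
  have hZ : entry (matZ R n) i 0 = 0 := by
    rw [entry_of_lt (by omega) (by omega), matZ_eq, Matrix.smul_apply, Matrix.one_apply_ne,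
      smul_zero]
    simpa using Nat.ne_of_gt hi
  rw [normalFormOver_eq hn, entry_add, entry_add, entry_add, entry_sum,
    Finset.sum_eq_single_of_mem i (Finset.mem_Icc.2 ⟨hi, hin⟩), hX, entry_smul, entry_smul, hH, hZ,
    entry_smul]
  · ring
  · intro k _ hk
    rw [entry_smul, entry_of_lt (by omega) (by omega), matY_pow_apply_ne, mul_zero]
    simpa using hk.symm

theorem map_normalFormOver (e : R →ₐ[ℝ] ℝ) (α β γ : R) (θ : ℕ → R) :
    (normalFormOver n α β γ θ).map e = normalForm n (e α) (e β) (e γ) fun i => e (θ i) := by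
  have hs : ∀ (c : R) (m : Mat n R), e.mapMatrix (c • m) = e c • e.mapMatrix m := by
    intro c m
    ext i j
    simp
  have h : ∀ m : Mat n ℝ, e.mapMatrix (m.map (algebraMap ℝ R)) = m := by
    intro m
    ext i j
    simp
  change e.mapMatrix _ = _
  simp only [normalFormOver, normalForm, map_add, map_neg, map_sum, hs, map_pow, matX, matY, matH,
    matZ, h]

end Entries

/-! ### Smoothness of the coefficients, which the notion of normal frame does not presuppose. -/

section Extraction

variable {E : Type*} [NormedAddCommGroup E] [NormedSpace ℝ E] {W : Set E} {n : ℕ}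

/-- The coefficients of a smooth matrix in normal form are smooth. -/
theorem exists_eq_normalFormOver (hn : 1 ≤ n) {B : Mat n (smoothOn W)} {α β γ : E → ℝ}
    {θ : ℕ → E → ℝ} (h : ∀ q : W, B.map (smoothOn.eval q) =
      normalForm n (α q) (β q) (γ q) fun i => θ i q) :
    ∃ (a b c : smoothOn W) (t : ℕ → smoothOn W), B = normalFormOver n a b c t ∧
      ∀ i ∈ Finset.Icc 3 (n + 1), ∀ q : W, (t i).1 q = θ i q := by
  have hn' : (n : ℝ) ≠ 0 := by positivity
  have h' : ∀ q : W, B.map (smoothOn.eval q) =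
      normalFormOver n (α q) (β q) (γ q) fun i => θ i q := by
    intro q
    rw [h q]
    have := map_normalFormOver (n := n) (AlgHom.id ℝ ℝ) (α q) (β q) (γ q) fun i => θ i q
    simpa using this.symm
  have hcol : ∀ k : ℕ, ∃ y : ℝ, y ≠ 0 ∧ (k ≤ n → entry (matY ℝ n ^ k) k 0 = y) := by
    intro k
    obtain ⟨y, hy, hY⟩ := exists_entry_matY_pow (R := ℝ) (n := n) k
    by_cases hk : k ≤ n
    · refine ⟨y 0, (hy 0 (by omega)).ne', fun _ => ?_⟩
      simpa using hY 0 (by omega)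
    · exact ⟨1, one_ne_zero, fun h => absurd h hk⟩
  choose y hy0 hy using hcol
  have hev : ∀ (q : W) (i j : ℕ), smoothOn.eval q (entry B i j) =
      entry (normalFormOver n (α q) (β q) (γ q) fun i => θ i q) i j := fun q i j => by
    rw [← h' q]
    exact map_entry (smoothOn.eval q).toRingHom B i j
  -- The first two diagonal entries are `n α + n β` and `(n - 2) α + n β`.
  set a : smoothOn W := (2 : ℝ)⁻¹ • (entry B 0 0 - entry B 1 1)
  set t : ℕ → smoothOn W := fun i => (y (i - 1))⁻¹ • entry B (i - 1) 0
  have ha : ∀ q, smoothOn.eval q a = α q := by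
    intro q
    simp only [a, map_smul, map_sub, hev, entry_normalFormOver_diag hn _ _ _ _ hn,
      entry_normalFormOver_diag hn _ _ _ _ (Nat.zero_le n), smul_eq_mul]
    push_cast
    ring
  have hb : ∀ q, smoothOn.eval q ((n : ℝ)⁻¹ • entry B 0 0 - a) = β q := by
    intro q
    rw [map_sub, ha, map_smul, hev, entry_normalFormOver_diag hn _ _ _ _ (Nat.zero_le n)]
    simp only [smul_eq_mul]
    push_cast
    field_simp
    ring
  have hc : ∀ q, smoothOn.eval q ((y 1)⁻¹ • entry B 1 0) = γ q := by
    intro q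
    rw [map_smul, hev, entry_normalFormOver_col hn _ _ _ _ le_rfl hn, if_pos rfl, hy 1 hn,
      smul_eq_mul]
    field_simp [hy0 1]
  have ht : ∀ i ∈ Finset.Icc 3 (n + 1), ∀ q : W, smoothOn.eval q (t i) = θ i q := by
    intro i hi q
    obtain ⟨h3, hin⟩ := Finset.mem_Icc.1 hi
    simp only [t]
    rw [map_smul, hev, entry_normalFormOver_col hn _ _ _ _ (by omega) (by omega),
      if_neg (by omega), hy _ (by omega), smul_eq_mul, Nat.sub_add_cancel (by omega)]
    field_simp [hy0 (i - 1)]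
  refine ⟨a, (n : ℝ)⁻¹ • entry B 0 0 - a, (y 1)⁻¹ • entry B 1 0, t,
    smoothOn.matrix_ext fun q => ?_, ht⟩
  rw [h q, map_normalFormOver, ha, hb, hc]
  unfold normalForm
  congr 1
  refine Finset.sum_congr rfl fun i hi => ?_
  obtain ⟨h2, hin⟩ := Finset.mem_Icc.1 hi
  exact congrArg (· • opY n ^ i) (ht _ (Finset.mem_Icc.2 ⟨by omega, by omega⟩) q).symm

end Extraction

/-! ### From moving frames to gauge transformations and back. -/

section Frames

variable {n : ℕ} {f : Jet n → ℝ} {W : Set (Jet n)} {S : Fin (n + 1) → Jet n → Jet n}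

/-- The condition on a moving frame to respect the filtrations at a point. -/
def IsFilteredFrame (f : Jet n → ℝ) (S : Fin (n + 1) → Jet n → Jet n) (q : Jet n) : Prop :=
  ∀ i : Fin (n + 1),
    Submodule.span ℝ ((fun j => S j q) '' {j | i ≤ j}) ⊔ lineField f q = normalFiltration f i q

theorem IsFilteredFrame.mem {q : Jet n} (h : IsFilteredFrame f S q) (j : Fin (n + 1)) :
    S j q ∈ normalFiltration f j q := by
  rw [← h j]
  exact Submodule.mem_sup_left (Submodule.subset_span ⟨j, le_refl j, rfl⟩)

/-- Otherwise `S i, …, S n` and `E` would all lie in the hyperplane where the `i`-th normal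
coordinate vanishes, whereas `N_i` contains `∂/∂y_i`. -/
theorem IsFilteredFrame.normalCoord_self_ne_zero {q : Jet n} (hf : DifferentiableAt ℝ f q)
    (h : IsFilteredFrame f S q) (i : Fin (n + 1)) : normalCoord f q (S i q) i ≠ 0 := by
  intro h0
  have hle : normalFiltration f i q ≤
      LinearMap.ker ((LinearMap.proj i).comp (normalCoord f q)) := by
    rw [← h i]
    refine sup_le (Submodule.span_le.2 ?_) fun v hv => ?_
    · rintro _ ⟨j, hj, rfl⟩
      rcases eq_or_lt_of_le (show i ≤ j from hj) with rfl | hlt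
      · exact h0
      · exact (mem_normalFiltration hf).1 (h.mem j) i hlt
    · exact congrFun ((mem_lineField hf).1 hv) i
  have hmem : ((0 : ℝ), (Pi.single i 1 : Fin (n + 1) → ℝ)) ∈ normalFiltration f i q := by
    rw [mem_normalFiltration hf]
    intro j hj
    simp [normalCoord_apply, hj.ne]
  have := hle hmem
  simp [normalCoord_apply] at this

/-- The inverse of `b` is again lower triangular, so a vector whose first `i` normal coordinates
vanish is, modulo `E`, a combination of the `S j` with `i ≤ j`. -/
theorem isFilteredFrame_of_lowerBand {q : Jet n} (hf : DifferentiableAt ℝ f q) {b : Mat n ℝ}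
    (hb : b ∈ lowerBand ℝ n 0) (hu : ∀ i, IsUnit (b i i))
    (hS : ∀ k j, normalCoord f q (S j q) k = b k j) : IsFilteredFrame f S q := by
  obtain ⟨c, hc, hbc, -⟩ := exists_inverse_lowerBand hb hu
  intro i
  refine le_antisymm (sup_le (Submodule.span_le.2 ?_) (lineField_le_normalFiltration hf i))
    fun v hv => ?_
  · rintro _ ⟨j, hj, rfl⟩
    refine (mem_normalFiltration hf).2 fun k hk => ?_
    have hk' := Fin.lt_def.1 hk
    have hj' := Fin.le_def.1 (show i ≤ j from hj)
    rw [hS, hb k j (by omega)]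
  · set w := normalCoord f q v with hw
    have hv' := (mem_normalFiltration hf).1 hv
    set x := c.mulVec w with hx
    have hx0 : ∀ j < i, x j = 0 := by
      intro j hj
      rw [hx, Matrix.mulVec, dotProduct]
      refine Finset.sum_eq_zero fun k _ => ?_
      rcases lt_or_ge k i with hk | hk
      · rw [hw, hv' k hk, mul_zero]
      · have hj' := Fin.lt_def.1 hj
        have hk' := Fin.le_def.1 hk
        rw [hc j k (by omega), zero_mul]
    have hsum : v = ∑ j, x j • S j q + (v - ∑ j, x j • S j q) := by abel
    rw [hsum]
    refine Submodule.add_mem_sup (Submodule.sum_mem _ fun j _ => ?_) ?_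
    · rcases lt_or_ge j i with hj | hj
      · rw [hx0 j hj, zero_smul]
        exact zero_mem _
      · exact Submodule.smul_mem _ _ (Submodule.subset_span ⟨j, hj, rfl⟩)
    · rw [mem_lineField hf, map_sub, map_sum, sub_eq_zero]
      have : b.mulVec x = w := by rw [hx, Matrix.mulVec_mulVec, hbc, Matrix.one_mulVec]
      rw [← hw, ← this]
      ext k
      simp [Matrix.mulVec, dotProduct, hS, mul_comm]

theorem differentiableAt_of_contDiffOn {F G : Type*} [NormedAddCommGroup F] [NormedSpace ℝ F]
    [NormedAddCommGroup G] [NormedSpace ℝ G] {V : Set F} (hV : IsOpen V) {u : F → G}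
    (hu : ContDiffOn ℝ ∞ u V) {q : F} (hq : q ∈ V) : DifferentiableAt ℝ u q :=
  (hu.contDiffAt (hV.mem_nhds hq)).differentiableAt (by simp)

theorem contDiffOn_normalCoord (hf : ContDiffOn ℝ ∞ f W) {T : Jet n → Jet n}
    (hT : ContDiffOn ℝ ∞ T W) (k : Fin (n + 1)) :
    ContDiffOn ℝ ∞ (fun q => normalCoord f q (T q) k) W :=
  (contDiffOn_pi.1 hT.snd k).sub (hT.fst.mul (contDiffOn_pi.1 (contDiffOn_totalD hf).snd k))

theorem contDiffOn_coordConnection (hW : IsOpen W) (hf : ContDiffOn ℝ ∞ f W)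
    (k i : Fin (n + 1)) : ContDiffOn ℝ ∞ (fun q => coordConnection f q k i) W :=
  (contDiffOn_pi.1 ((((contDiffOn_totalD hf).fderiv_of_isOpen hW (by simp)).clm_apply
    contDiffOn_const).snd) k).neg

/-- The derivation along `D`. -/
def alongD (hW : IsOpen W) (hf : ContDiffOn ℝ ∞ f W) :
    Derivation ℝ (smoothOn W) (smoothOn W) := alongField hW (contDiffOn_totalD hf)

/-- The matrix of smooth functions of the partial connection in the coordinate frame. -/
def connectionMat (hW : IsOpen W) (hf : ContDiffOn ℝ ∞ f W) : Mat n (smoothOn W) :=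
  Matrix.of fun k i => smoothOn.mk (contDiffOn_coordConnection hW hf k i)

/-- The matrix of smooth functions of a moving frame with respect to the coordinate frame. -/
def frameMat (hf : ContDiffOn ℝ ∞ f W) (hS : ∀ j, ContDiffOn ℝ ∞ (S j) W) : Mat n (smoothOn W) :=
  Matrix.of fun k j => smoothOn.mk (contDiffOn_normalCoord hf (hS j) k)

theorem eval_gauge_frameMat (hW : IsOpen W) (hf : ContDiffOn ℝ ∞ f W)
    (hS : ∀ j, ContDiffOn ℝ ∞ (S j) W) (q : W) (k j : Fin (n + 1)) :
    smoothOn.eval q ((connectionMat hW hf * frameMat hf hS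
      + (frameMat hf hS).map (alongD hW hf)) k j) =
      normalCoord f q (VectorField.lieBracket ℝ (totalD f) (S j) q) k := by
  rw [normalCoord_lieBracket (differentiableAt_of_contDiffOn hW (contDiffOn_totalD hf) q.2)
    (differentiableAt_of_contDiffOn hW (hS j) q.2), Matrix.add_apply,
    map_add (smoothOn.eval q), Matrix.mul_apply, map_sum (smoothOn.eval q), Matrix.map_apply, alongD,
    eval_alongField]
  refine congrArg₂ (· + ·) ?_ ?_
  · rw [Matrix.mulVec, dotProduct]
    refine Finset.sum_congr rfl fun i _ => ?_
    rw [map_mul (smoothOn.eval q)]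
    rfl
  · have : smoothOn.repr (frameMat hf hS k j) =ᶠ[nhds (q : Jet n)]
        fun p => normalCoord f p (S j p) k :=
      smoothOn.repr_eventuallyEq hW q fun p => rfl
    rw [this.fderiv_eq]

theorem frameMat_mem (hW : IsOpen W) (hf : ContDiffOn ℝ ∞ f W) (hS : ∀ j, ContDiffOn ℝ ∞ (S j) W)
    (hfil : ∀ q ∈ W, IsFilteredFrame f S q) : frameMat hf hS ∈ lowerBand (smoothOn W) n 0 := by
  intro k j hkj
  refine smoothOn.ext_eval fun q => ?_
  rw [map_zero]
  exact (mem_normalFiltration (differentiableAt_of_contDiffOn hW hf q.2)).1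
    ((hfil q q.2).mem j) k (Fin.lt_def.2 hkj)

theorem isUnit_frameMat (hW : IsOpen W) (hf : ContDiffOn ℝ ∞ f W)
    (hS : ∀ j, ContDiffOn ℝ ∞ (S j) W) (hfil : ∀ q ∈ W, IsFilteredFrame f S q)
    (i : Fin (n + 1)) : IsUnit (frameMat hf hS i i) :=
  smoothOn.isUnit fun q =>
    (hfil q q.2).normalCoord_self_ne_zero (differentiableAt_of_contDiffOn hW hf q.2) i

/-- A moving frame whose connection matrix is a multiple of a normal form defines a change of frame
over the algebra of smooth functions. -/
theorem exists_isGauge_of_frame (hn : 1 ≤ n) (hW : IsOpen W) (hf : ContDiffOn ℝ ∞ f W)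
    (hS : ∀ j, ContDiffOn ℝ ∞ (S j) W) (hfil : ∀ q ∈ W, IsFilteredFrame f S q)
    {lam : Jet n → ℝ} (hlam : ContDiffOn ℝ ∞ lam W) (hlam0 : ∀ q ∈ W, lam q ≠ 0)
    {α β γ : Jet n → ℝ} {θ : ℕ → Jet n → ℝ}
    (hconn : ∀ q ∈ W, ∀ j, VectorField.lieBracket ℝ (totalD f) (S j) q
      - lam q • ∑ k, normalForm n (α q) (β q) (γ q) (fun i => θ i q) k j • S k q
        ∈ lineField f q) :
    ∃ (a b c : smoothOn W) (t : ℕ → smoothOn W),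
      IsGauge (alongD hW hf) (frameMat hf hS) (connectionMat hW hf)
        (smoothOn.mk hlam • normalFormOver n a b c t) ∧
      ∀ i ∈ Finset.Icc 3 (n + 1), ∀ q : W, (t i).1 q = θ i q := by
  set F := frameMat hf hS with hF
  obtain ⟨F', -, hFF', hF'F⟩ := exists_inverse_lowerBand (frameMat_mem hW hf hS hfil)
    (isUnit_frameMat hW hf hS hfil)
  have hlamU : IsUnit (smoothOn.mk hlam) := smoothOn.isUnit fun q => hlam0 q q.2
  obtain ⟨ν, hν⟩ := hlamU.exists_left_inv
  -- `B` is obtained by solving the gauge equation over the ring of smooth functions; only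
  -- afterwards is it seen pointwise to be a normal form.
  set B := ν • (F' * (connectionMat hW hf * F + F.map (alongD hW hf))) with hB
  have hgauge : IsGauge (alongD hW hf) F (connectionMat hW hf) (smoothOn.mk hlam • B) := by
    unfold IsGauge
    rw [hB, smul_smul, mul_comm, hν, one_smul, ← mul_assoc, hFF', one_mul]
  have hBev : ∀ q : W, B.map (smoothOn.eval q) =
      normalForm n (α q) (β q) (γ q) fun i => θ i q := by
    intro q
    set e := smoothOn.eval q with he
    have hs : ∀ (c : smoothOn W) (m : Mat n (smoothOn W)),
        e.mapMatrix (c • m) = e c • e.mapMatrix m := by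
      intro c m
      ext i j
      simp
    have h1 : e.mapMatrix (connectionMat hW hf * F + F.map (alongD hW hf)) =
        lam q • (e.mapMatrix F * normalForm n (α q) (β q) (γ q) fun i => θ i q) := by
      ext k j
      have h2 := (mem_lineField (differentiableAt_of_contDiffOn hW hf q.2)).1 (hconn q q.2 j)
      rw [map_sub, sub_eq_zero, map_smul, map_sum] at h2
      have h3 := congrFun h2 k
      rw [← eval_gauge_frameMat hW hf hS] at h3
      refine h3.trans ?_
      rw [Pi.smul_apply, Finset.sum_apply, Matrix.smul_apply, Matrix.mul_apply]
      congr 1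
      refine Finset.sum_congr rfl fun i _ => ?_
      rw [map_smul, Pi.smul_apply, smul_eq_mul, mul_comm]
      rfl
    have h4 : e ν * lam q = 1 := by
      have := congrArg e hν
      rwa [map_mul, map_one] at this
    have h5 : e.mapMatrix F' * e.mapMatrix F = 1 := by rw [← map_mul, hF'F, map_one]
    change e.mapMatrix B = _
    rw [hB, hs, map_mul, h1, mul_smul_comm, smul_smul, h4, one_smul, ← mul_assoc, h5, one_mul]
  obtain ⟨a, b, c, t, hBt, ht⟩ := exists_eq_normalFormOver hn hBev
  exact ⟨a, b, c, t, hBt ▸ hgauge, ht⟩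

/-- The coefficients `θ i` of two frames, where the second is normal for the field `lam⁻¹ • D`. -/
theorem coeff_eq_of_frames (hn : 1 ≤ n) (hW : IsOpen W) (hf : ContDiffOn ℝ ∞ f W)
    {T : Fin (n + 1) → Jet n → Jet n}
    (hS : ∀ j, ContDiffOn ℝ ∞ (S j) W) (hT : ∀ j, ContDiffOn ℝ ∞ (T j) W)
    (hSfil : ∀ q ∈ W, IsFilteredFrame f S q) (hTfil : ∀ q ∈ W, IsFilteredFrame f T q)
    {lam : Jet n → ℝ} (hlam : ContDiffOn ℝ ∞ lam W) (hlam0 : ∀ q ∈ W, lam q ≠ 0)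
    {α β γ α' β' γ' : Jet n → ℝ} {θ θ' : ℕ → Jet n → ℝ}
    (hSconn : ∀ q ∈ W, ∀ j, VectorField.lieBracket ℝ (totalD f) (S j) q
      - ∑ k, normalForm n (α q) (β q) (γ q) (fun i => θ i q) k j • S k q ∈ lineField f q)
    (hTconn : ∀ q ∈ W, ∀ j, VectorField.lieBracket ℝ (totalD f) (T j) q
      - lam q • ∑ k, normalForm n (α' q) (β' q) (γ' q) (fun i => θ' i q) k j • T k q
        ∈ lineField f q) :
    ∀ i ∈ Finset.Icc 3 (n + 1), ∀ q ∈ W, θ i q = lam q ^ i * θ' i q := by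
  obtain ⟨a, b, c, t, h1, ht⟩ := exists_isGauge_of_frame hn hW hf hS hSfil
    (lam := fun _ => 1) contDiffOn_const (fun _ _ => one_ne_zero)
    (fun q hq j => by simpa using hSconn q hq j)
  obtain ⟨a', b', c', t', h2, ht'⟩ := exists_isGauge_of_frame hn hW hf hT hTfil hlam hlam0 hTconn
  have h1' : IsGauge (alongD hW hf) (frameMat hf hS) (connectionMat hW hf)
      (normalFormOver n a b c t) := by
    convert h1 using 1
    exact (one_smul (smoothOn W) _).symm
  obtain ⟨F', hF', hFF', hF'F⟩ := exists_inverse_lowerBand (frameMat_mem hW hf hS hSfil)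
    (isUnit_frameMat hW hf hS hSfil)
  -- The transition matrix from `S` to `T`; the coordinate frame cancels by `IsGauge.of_comp`.
  set g := F' * frameMat hf hT with hg
  have hFg : frameMat hf hS * g = frameMat hf hT := by rw [hg, ← mul_assoc, hFF', one_mul]
  have hgmem : g ∈ lowerBand (smoothOn W) n 0 :=
    mul_mem_lowerBand hF' (frameMat_mem hW hf hT hTfil)
  have h3 := h1'.of_comp (g := g) (by rw [hFg]; exact h2) (IsUnit.of_mul_eq_one F' hFF')
  have hg0 : IsUnit (g 0 0) := by
    refine isUnit_of_mul_isUnit_right (x := frameMat hf hS 0 0) ?_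
    rw [← mul_apply_zero_zero hgmem (frameMat_mem hW hf hS hSfil), hFg]
    exact isUnit_frameMat hW hf hT hTfil 0
  intro i hi q hq
  have := congrArg (smoothOn.eval ⟨q, hq⟩)
    (coeff_eq_of_isGauge hn (smoothOn.isUnit fun q => hlam0 q q.2) hgmem hg0 h3 i hi)
  rw [map_mul, map_pow] at this
  simp only [smoothOn.eval_apply, ht i hi, ht' i hi] at this
  exact this

/-- Normal frames exist. -/
theorem exists_isNormalFrame (hn : 1 ≤ n) (hW : IsOpen W) (hf : ContDiffOn ℝ ∞ f W) :
    ∃ (S : Fin (n + 1) → Jet n → Jet n) (α β γ : Jet n → ℝ) (θ : ℕ → Jet n → ℝ),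
      IsNormalFrame f W S α β γ θ ∧ ∀ i, ContDiffOn ℝ ∞ (θ i) W := by
  set C := connectionMat hW hf with hC
  set c := algebraMap ℝ (smoothOn W) with hc
  have hcmul : ∀ x y, c x * c y = c (x * y) := fun x y => (map_mul c x y).symm
  -- In the coordinate frame the superdiagonal of the connection consists of `-1`, while that of
  -- `-X` is `-1, …, -n`. Rescaling by factorials turns one into the other, as `(k + 1)! / k! = k +
  -- 1`.
  set φ : ℕ → ℝ := fun i => (i.factorial : ℝ) with hφ
  have hφ0 : ∀ i, φ i ≠ 0 := fun i => by positivity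
  set F : Mat n (smoothOn W) := Matrix.diagonal fun j => c (φ j) with hF
  set A : Mat n (smoothOn W) := (Matrix.diagonal fun j : Fin (n + 1) => c (φ j)⁻¹) * C * F with hA
  -- Above the diagonal `k` is never the last index, so `f` does not enter and the component of `D`
  -- is just `y_{k+1}`.
  have hCentry : ∀ k i : Fin (n + 1), (k : ℕ) < i →
      C k i = if (k : ℕ) + 1 = i then -1 else 0 := by
    intro k i hki
    refine smoothOn.ext_eval fun q => ?_
    have hk : (k : ℕ) + 1 < n + 1 := by have := i.2; omega
    have hd := differentiableAt_of_contDiffOn hW (contDiffOn_totalD hf) q.2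
    have h1 : HasFDerivAt (fun p => (totalD f p).2 k) _ (q : Jet n) :=
      hasFDerivAt_pi'.1 hd.hasFDerivAt.snd k
    have h2 : (fun p => (totalD f p).2 k) = fun p : Jet n => p.2 ⟨(k : ℕ) + 1, hk⟩ := by
      ext p
      simp only [totalD]
      rw [dif_pos hk]
    rw [h2] at h1
    have hsnd : HasFDerivAt (fun p : Jet n => p.2)
        (ContinuousLinearMap.snd ℝ ℝ (Fin (n + 1) → ℝ)) (q : Jet n) := hasFDerivAt_snd
    have h3 := h1.unique (hasFDerivAt_pi'.1 hsnd ⟨(k : ℕ) + 1, hk⟩)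
    have h4 : (fderiv ℝ (totalD f) q (0, Pi.single i 1)).2 k
        = (Pi.single i 1 : Fin (n + 1) → ℝ) ⟨(k : ℕ) + 1, hk⟩ :=
      DFunLike.congr_fun h3 ((0 : ℝ), (Pi.single i 1 : Fin (n + 1) → ℝ))
    have h5 : smoothOn.eval q (C k i) = -(fderiv ℝ (totalD f) q (0, Pi.single i 1)).2 k := rfl
    rw [h5, h4]
    split_ifs with h
    · obtain rfl : (⟨(k : ℕ) + 1, hk⟩ : Fin (n + 1)) = i := Fin.ext h
      rw [Pi.single_eq_same, map_neg, map_one]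
    · rw [Pi.single_eq_of_ne (fun h' => h (congrArg Fin.val h')), neg_zero, map_zero]
  have hAX : A + matX (smoothOn W) n ∈ lowerBand (smoothOn W) n 0 := by
    intro k i hki
    rw [add_zero] at hki
    rw [Matrix.add_apply, hA, hF, Matrix.mul_diagonal, Matrix.diagonal_mul, hCentry k i hki,
      matX_apply]
    split_ifs with h
    · have h1 : c (φ k)⁻¹ * c (φ i) = algebraMap ℝ (smoothOn W) ((i : ℕ) : ℝ) := by
        rw [hcmul, ← hc]
        congr 1
        simp only [hφ, ← h, Nat.factorial_succ]
        push_cast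
        field_simp
      linear_combination (-1 : smoothOn W) * h1
    · simp
  obtain ⟨g, β, γ, t, hg, hgauge⟩ :=
    exists_isGauge_normalFormOver (δ := alongD hW hf) hn hAX
  have hFA : IsGauge (alongD hW hf) F C A := by
    have hF0 : F.map (alongD hW hf) = 0 := by
      ext i j : 2
      by_cases h : i = j
      · subst h
        simp [hF, hc]
      · simp [hF, Matrix.diagonal_apply_ne _ h]
    unfold IsGauge
    rw [hF0, add_zero, hA, ← mul_assoc, ← mul_assoc, hF, Matrix.diagonal_mul_diagonal]
    have : (fun i : Fin (n + 1) => c (φ i) * c (φ i)⁻¹) = fun _ => 1 := by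
      ext i : 1
      rw [hcmul, mul_inv_cancel₀ (hφ0 _), hc, map_one]
    rw [this, Matrix.diagonal_one, one_mul]
  have hb := hFA.comp hgauge
  set b := F * g with hbdef
  have hg0 : g ∈ lowerBand (smoothOn W) n 0 := by
    have := add_mem (lowerBand_anti (Nat.zero_le 1) hg) (one_mem_lowerBand (R := smoothOn W) (n := n))
    rwa [sub_add_cancel] at this
  have hbmem : b ∈ lowerBand (smoothOn W) n 0 :=
    mul_mem_lowerBand (diagonal_mem_lowerBand _) hg0
  have hbdiag : ∀ i, b i i = c (φ i) := by
    intro i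
    have h1 := hg i i (by omega)
    rw [Matrix.sub_apply, Matrix.one_apply_eq, sub_eq_zero] at h1
    rw [hbdef, hF, Matrix.diagonal_mul, h1, mul_one]
  set S : Fin (n + 1) → Jet n → Jet n := fun j q => (0, fun k => smoothOn.repr (b k j) q) with hSdef
  have hS : ∀ j, ContDiffOn ℝ ∞ (S j) W := fun j =>
    contDiffOn_const.prodMk (contDiffOn_pi.2 fun k => smoothOn.contDiffOn (b k j))
  have hcoord : ∀ (q : W) (k j : Fin (n + 1)),
      normalCoord f q (S j q) k = smoothOn.eval q (b k j) := by
    intro q k j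
    simp [normalCoord_apply, hSdef, smoothOn.repr_coe, smoothOn.eval_apply]
  have hframe : frameMat hf hS = b := smoothOn.matrix_ext fun q => by
    ext k j
    exact hcoord q k j
  refine ⟨S, 0, smoothOn.repr β, smoothOn.repr γ, fun i => smoothOn.repr (t i),
    ⟨hW, hS, fun q hq => ?_, fun q hq j => ?_⟩, fun i => smoothOn.contDiffOn (t i)⟩
  · have hd := differentiableAt_of_contDiffOn hW hf hq
    refine isFilteredFrame_of_lowerBand hd (b := b.map (smoothOn.eval ⟨q, hq⟩))
      (fun k j h => ?_) (fun i => ?_) fun k j => hcoord ⟨q, hq⟩ k j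
    · rw [Matrix.map_apply, hbmem k j h, map_zero]
    · rw [Matrix.map_apply, hbdiag, hc, AlgHom.commutes]
      exact (isUnit_iff_ne_zero).2 (hφ0 _)
  · rw [mem_lineField (differentiableAt_of_contDiffOn hW hf hq), map_sub, sub_eq_zero, map_sum]
    ext k
    have h1 := eval_gauge_frameMat hW hf hS ⟨q, hq⟩ k j
    rw [hframe, ← hC] at h1
    unfold IsGauge at hb
    rw [← hb] at h1
    refine h1.symm.trans ?_
    have h2 := map_normalFormOver (n := n) (smoothOn.eval ⟨q, hq⟩) 0 β γ t
    have h3 : ∀ u : smoothOn W, smoothOn.repr u q = smoothOn.eval ⟨q, hq⟩ u := fun u =>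
      smoothOn.repr_coe u ⟨q, hq⟩
    rw [Matrix.mul_apply, map_sum, Finset.sum_apply]
    refine Finset.sum_congr rfl fun i _ => ?_
    rw [map_mul, map_smul, Pi.smul_apply, hcoord ⟨q, hq⟩, smul_eq_mul, mul_comm]
    congr 1
    simp only [h3, Pi.zero_apply]
    rw [← map_zero (smoothOn.eval ⟨q, hq⟩), ← h2]
    rfl

end Frames

/-! ### The invariants are well defined and smooth. -/

section Invariants

variable {n : ℕ} {f : Jet n → ℝ} {Ω : Set (Jet n)}

theorem IsNormalFrame.mono {U V : Set (Jet n)} {S : Fin (n + 1) → Jet n → Jet n}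
    {α β γ : Jet n → ℝ} {θ : ℕ → Jet n → ℝ} (h : IsNormalFrame f U S α β γ θ) (hV : IsOpen V)
    (hVU : V ⊆ U) : IsNormalFrame f V S α β γ θ :=
  ⟨hV, fun j => (h.contDiffOn j).mono hVU, fun q hq => h.filtration q (hVU hq),
    fun q hq => h.connection q (hVU hq)⟩

theorem IsWilczynskiValue.unique (hn : 1 ≤ n) (hΩ : IsOpen Ω) (hf : ContDiffOn ℝ ∞ f Ω) {i : ℕ}
    (hi : i ∈ Finset.Icc 3 (n + 1)) {q : Jet n} (hq : q ∈ Ω) {s t : ℝ}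
    (hs : IsWilczynskiValue f i q s) (ht : IsWilczynskiValue f i q t) : s = t := by
  obtain ⟨U, S, α, β, γ, θ, hqU, hU, rfl⟩ := hs
  obtain ⟨V, T, α', β', γ', θ', hqV, hV, rfl⟩ := ht
  -- The domains of the two frames may leave `Ω`, where `f` need not be smooth. On the intersection
  -- `coeff_eq_of_frames` applies with `lam = 1`.
  have hW : IsOpen (U ∩ V ∩ Ω) := (hU.isOpen.inter hV.isOpen).inter hΩ
  have hU' := hU.mono hW fun p hp => hp.1.1
  have hV' := hV.mono hW fun p hp => hp.1.2
  have := coeff_eq_of_frames hn hW (hf.mono fun p hp => hp.2) hU'.contDiffOn hV'.contDiffOn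
    hU'.filtration hV'.filtration (lam := fun _ => 1) contDiffOn_const
    (fun _ _ => one_ne_zero) hU'.connection
    (fun p hp j => by simpa using hV'.connection p hp j) i hi q ⟨⟨hqU, hqV⟩, hq⟩
  simpa using this

theorem existsUnique_isWilczynskiValue (hn : 1 ≤ n) (hΩ : IsOpen Ω) (hf : ContDiffOn ℝ ∞ f Ω)
    {i : ℕ} (hi : i ∈ Finset.Icc 3 (n + 1)) {q : Jet n} (hq : q ∈ Ω) :
    ∃! t, IsWilczynskiValue f i q t := by
  obtain ⟨S, α, β, γ, θ, h, -⟩ := exists_isNormalFrame hn hΩ hf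
  exact ⟨θ i q, ⟨Ω, S, α, β, γ, θ, hq, h, rfl⟩, fun t ht =>
    ht.unique hn hΩ hf hi hq ⟨Ω, S, α, β, γ, θ, hq, h, rfl⟩⟩

theorem wilczynskiFun_eq (hn : 1 ≤ n) (hΩ : IsOpen Ω) (hf : ContDiffOn ℝ ∞ f Ω)
    {i : ℕ} (hi : i ∈ Finset.Icc 3 (n + 1)) {q : Jet n} (hq : q ∈ Ω) {t : ℝ}
    (ht : IsWilczynskiValue f i q t) : wilczynskiFun f i q = t :=
  IsWilczynskiValue.unique hn hΩ hf hi hq (Classical.epsilon_spec ⟨t, ht⟩) ht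

/-- A single normal frame exists over all of `Ω`, and its smooth coefficient is the invariant. -/
theorem contDiffOn_wilczynskiFun (hn : 1 ≤ n) (hΩ : IsOpen Ω) (hf : ContDiffOn ℝ ∞ f Ω)
    {i : ℕ} (hi : i ∈ Finset.Icc 3 (n + 1)) : ContDiffOn ℝ ∞ (wilczynskiFun f i) Ω := by
  obtain ⟨S, α, β, γ, θ, h, hθ⟩ := exists_isNormalFrame hn hΩ hf
  exact (hθ i).congr fun q hq =>
    wilczynskiFun_eq hn hΩ hf hi hq ⟨Ω, S, α, β, γ, θ, hq, h, rfl⟩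

end Invariants

theorem minSmoothness_two_le : minSmoothness ℝ 2 ≤ ∞ := by
  rw [minSmoothness_of_isRCLikeNormedField]
  exact WithTop.coe_le_coe.2 (le_top : (2 : ℕ∞) ≤ ⊤)

/-! ### Contact transformations preserve the whole flag of lower contact distributions. -/

section ContactFlag

variable {k : ℕ}

/-- The preimage of the contact distribution of `J^i` in the tangent space of `J^k`. -/
def contactFlag (k i : ℕ) (p : Jet k) : Submodule ℝ (Jet k) where
  carrier := {v | ∀ (j : ℕ) (h : j + 1 < k + 1), j < i →
    v.2 ⟨j, by omega⟩ = v.1 * p.2 ⟨j + 1, h⟩}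
  add_mem' {a b} ha hb j h hj := by
    simp [ha j h hj, hb j h hj, add_mul]
  zero_mem' j h _ := by simp
  smul_mem' c a ha j h hj := by
    simp [ha j h hj, mul_assoc]

theorem mem_contactFlag {i : ℕ} {p v : Jet k} : v ∈ contactFlag k i p ↔
    ∀ (j : ℕ) (h : j + 1 < k + 1), j < i → v.2 ⟨j, by omega⟩ = v.1 * p.2 ⟨j + 1, h⟩ := Iff.rfl

theorem contactFlag_self (p : Jet k) : contactFlag k k p = contactDist k p := by
  ext v
  rw [mem_contactFlag, mem_contactDist]
  exact ⟨fun h i hi => h i hi (by omega), fun h j hj _ => h ⟨j, by omega⟩ hj⟩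

theorem contactFlag_anti {i j : ℕ} (h : i ≤ j) (p : Jet k) :
    contactFlag k j p ≤ contactFlag k i p := fun _ hv l hl hli => hv l hl (by omega)

/-- Brackets of fields that are mapped into a member of the flag are mapped into the next one. -/
theorem fderiv_lieBracket_mem_contactFlag {φ : Jet k → Jet k} {i : ℕ} {p : Jet k}
    (hφ : ContDiffAt ℝ ∞ φ p) {V W : Jet k → Jet k} (hV : DifferentiableAt ℝ V p)
    (hW : DifferentiableAt ℝ W p) (hi : i + 1 ≤ k)
    (hφV : ∀ᶠ x in nhds p, fderiv ℝ φ x (V x) ∈ contactFlag k (i + 1) (φ x))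
    (hφW : ∀ᶠ x in nhds p, fderiv ℝ φ x (W x) ∈ contactFlag k (i + 1) (φ x)) :
    fderiv ℝ φ p (VectorField.lieBracket ℝ V W p) ∈ contactFlag k i (φ p) := by
  have hφd : DifferentiableAt ℝ φ p := hφ.differentiableAt (by simp)
  have hφ' : DifferentiableAt ℝ (fderiv ℝ φ) p :=
    (hφ.fderiv_right (m := ∞) (by simp)).differentiableAt (by simp)
  -- Differentiates along `w` the identity `dy_j = y_{j+1} dx` satisfied by the image of `U`.
  have key : ∀ {U : Jet k → Jet k}, DifferentiableAt ℝ U p →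
      (∀ᶠ x in nhds p, fderiv ℝ φ x (U x) ∈ contactFlag k (i + 1) (φ x)) →
      ∀ (j : ℕ) (h : j + 1 < k + 1), j < i → ∀ w,
        (fderiv ℝ (fun x => fderiv ℝ φ x (U x)) p w).2 ⟨j, by omega⟩ =
          (fderiv ℝ (fun x => fderiv ℝ φ x (U x)) p w).1 * (φ p).2 ⟨j + 1, h⟩
            + (fderiv ℝ φ p (U p)).1 * (fderiv ℝ φ p w).2 ⟨j + 1, h⟩ := by
    intro U hU hφU j h hj w
    have hA := (hφ'.clm_apply hU).hasFDerivAt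
    have h1 := hasFDerivAt_pi'.1 hA.snd ⟨j, by omega⟩
    have h2 := hA.fst.mul (hasFDerivAt_pi'.1 hφd.hasFDerivAt.snd ⟨j + 1, h⟩)
    have h3 := h1.unique (h2.congr_of_eventuallyEq (hφU.mono fun x hx => hx j h (by omega)))
    have h4 := DFunLike.congr_fun h3 w
    simp at h4
    rw [h4]
    ring
  intro j h hj
  rw [VectorField.fderiv_apply_lieBracket hφ minSmoothness_two_le hW hV]
  -- The extra terms of the bracket are products of `dx` and `dy_{j+1}` on the two images. They
  -- cancel because these images also satisfy the relation with index `j + 1`, which is why one step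
  -- of the flag is lost.
  have hB := hφV.self_of_nhds (j + 1) (by omega) (by omega)
  have hA := hφW.self_of_nhds (j + 1) (by omega) (by omega)
  rw [Prod.snd_sub, Prod.fst_sub, Pi.sub_apply, key hW hφW j h hj, key hV hφV j h hj, hA, hB]
  ring

/-- Descending induction from the contact distribution: the `i`-th member is the `(i+1)`-st plus the
line of `∂/∂y_i`, and `∂/∂y_i` is the bracket of `∂/∂y_{i+1}` with `∂/∂x + y_1 ∂/∂y_0 + …`, two
fields in the `(i+1)`-st. It is not needed that `φ` is a prolongation. -/
theorem fderiv_mem_contactFlag {φ : OpenPartialHomeomorph (Jet k) (Jet k)}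
    (hφ : IsLocalContact φ) {i : ℕ} (hi : i ≤ k) :
    ∀ p ∈ φ.source, ∀ v ∈ contactFlag k i p, fderiv ℝ φ p v ∈ contactFlag k i (φ p) := by
  induction hi using Nat.decreasingInduction with
  | self =>
    intro p hp v hv
    rw [contactFlag_self] at hv ⊢
    rw [← hφ.map_contactDist p hp]
    exact Submodule.mem_map_of_mem hv
  | of_succ i hi ih =>
    intro p hp v hv
    have hφp : ContDiffAt ℝ ∞ φ p := hφ.contDiffOn.contDiffAt (φ.open_source.mem_nhds hp)
    have hev : ∀ᶠ x in nhds p, x ∈ φ.source := φ.open_source.mem_nhds hp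
    set e : ℕ → Jet k := fun l => (0, fun j => if (j : ℕ) = l then 1 else 0) with he
    set L : Jet k →L[ℝ] Jet k := (0 : Jet k →L[ℝ] ℝ).prod (ContinuousLinearMap.pi fun j =>
      if h : (j : ℕ) + 1 < k + 1 then
        (ContinuousLinearMap.proj (R := ℝ) (φ := fun _ : Fin (k + 1) => ℝ)
          ⟨(j : ℕ) + 1, h⟩).comp (ContinuousLinearMap.snd ℝ ℝ _)
      else 0) with hL
    have hLapp : ∀ x : Jet k, L x = ((0 : ℝ), fun j : Fin (k + 1) =>
        if h : (j : ℕ) + 1 < k + 1 then x.2 ⟨(j : ℕ) + 1, h⟩ else 0) := by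
      intro x
      refine Prod.ext rfl (funext fun j => ?_)
      simp only [hL, ContinuousLinearMap.prod_apply, ContinuousLinearMap.coe_pi']
      split_ifs <;> rfl
    set W : Jet k → Jet k := fun x => ((1 : ℝ), (0 : Fin (k + 1) → ℝ)) + L x with hWdef
    have hWd : ∀ x, HasFDerivAt W L x := fun x => L.hasFDerivAt.const_add _
    have hWmem : ∀ x, W x ∈ contactFlag k (i + 1) x := by
      intro x j h _
      simp only [hWdef, hLapp, Prod.snd_add, Prod.fst_add, Pi.add_apply, Pi.zero_apply, zero_add,
        add_zero, one_mul]
      rw [dif_pos h]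
    have heMem : ∀ x, e (i + 1) ∈ contactFlag k (i + 1) x := by
      intro x j h hj
      simp only [he, zero_mul]
      rw [if_neg (by omega)]
    have hbr : VectorField.lieBracket ℝ (fun _ => e (i + 1)) W p = e i := by
      rw [VectorField.lieBracket_eq]
      simp only [(hWd p).fderiv, fderiv_const_apply, zero_apply, sub_zero, hLapp,
        he]
      refine Prod.ext rfl (funext fun j => ?_)
      change (if h : (j : ℕ) + 1 < k + 1 then if (j : ℕ) + 1 = i + 1 then (1 : ℝ) else 0 else 0)
        = if (j : ℕ) = i then 1 else 0
      split_ifs <;> first | rfl | omega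
    have h1 : fderiv ℝ φ p (e i) ∈ contactFlag k i (φ p) := by
      rw [← hbr]
      exact fderiv_lieBracket_mem_contactFlag hφp (differentiableAt_const _)
        (hWd p).differentiableAt hi
        (hev.mono fun x hx => ih x hx _ (heMem x)) (hev.mono fun x hx => ih x hx _ (hWmem x))
    -- The defect of `v` in the one relation that separates the two members; subtracting `c • e i`
    -- repairs it.
    set c : ℝ := v.2 ⟨i, by omega⟩ - v.1 * p.2 ⟨i + 1, by omega⟩ with hc
    have h2 : v - c • e i ∈ contactFlag k (i + 1) p := by
      intro j h hj
      simp only [he, Prod.snd_sub, Prod.fst_sub, Prod.smul_snd, Prod.smul_fst,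
        Pi.sub_apply, Pi.smul_apply, smul_eq_mul]
      by_cases hji : j = i
      · subst hji
        simp [hc]
      · rw [if_neg hji, mul_zero, sub_zero, sub_zero]
        exact hv j h (by omega)
    have h3 := add_mem (contactFlag_anti (Nat.le_succ i) _ (ih p hp _ h2))
      (Submodule.smul_mem _ c h1)
    rwa [← map_smul, ← map_add, sub_add_cancel] at h3

theorem fderiv_symm_comp {φ : OpenPartialHomeomorph (Jet k) (Jet k)} (hφ : IsLocalContact φ)
    {p : Jet k} (hp : p ∈ φ.source) (v : Jet k) :
    fderiv ℝ φ.symm (φ p) (fderiv ℝ φ p v) = v := by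
  have h1 : HasFDerivAt φ (fderiv ℝ φ p) p :=
    (differentiableAt_of_contDiffOn φ.open_source hφ.contDiffOn hp).hasFDerivAt
  have h2 : HasFDerivAt φ.symm (fderiv ℝ φ.symm (φ p)) (φ p) :=
    (differentiableAt_of_contDiffOn φ.open_target hφ.contDiffOn_symm
      (φ.map_source hp)).hasFDerivAt
  have h3 : (φ.symm ∘ φ) =ᶠ[nhds p] id :=
    Filter.eventually_of_mem (φ.open_source.mem_nhds hp) fun x hx => φ.left_inv hx
  exact DFunLike.congr_fun ((h2.comp p h1).unique ((hasFDerivAt_id p).congr_of_eventuallyEq h3)) v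

theorem IsLocalContact.symm {φ : OpenPartialHomeomorph (Jet k) (Jet k)} (hφ : IsLocalContact φ) :
    IsLocalContact φ.symm := by
  refine ⟨hφ.contDiffOn_symm, by simpa using hφ.contDiffOn, fun y hy => ?_⟩
  have hp : φ.symm y ∈ φ.source := φ.map_target hy
  have h1 := hφ.map_contactDist _ hp
  rw [φ.right_inv hy] at h1
  rw [← h1, ← Submodule.map_comp]
  have h2 : (fderiv ℝ φ.symm y : Jet k →ₗ[ℝ] Jet k) ∘ₗ (fderiv ℝ φ (φ.symm y) : Jet k →ₗ[ℝ] Jet k)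
      = LinearMap.id := by
    ext1
    · ext1
      have := fderiv_symm_comp hφ hp ((1 : ℝ), 0)
      rw [φ.right_inv hy] at this
      exact this
    · refine LinearMap.ext fun w => ?_
      have := fderiv_symm_comp hφ hp ((0 : ℝ), w)
      rw [φ.right_inv hy] at this
      exact this
  rw [h2, Submodule.map_id]

end ContactFlag

/-! ### Isomorphisms of filtered equations and the weight of the invariants. -/

section FilteredMaps

variable {n : ℕ} {f f' : Jet n → ℝ} {W W' : Set (Jet n)} {ψ χ : Jet n → Jet n}

/-- A smooth map between open sets of two equations that preserves the line fields and the
filtrations of the normal bundles. -/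
structure IsFilteredMap (f f' : Jet n → ℝ) (W W' : Set (Jet n)) (ψ : Jet n → Jet n) : Prop where
  contDiffOn : ContDiffOn ℝ ∞ ψ W
  mapsTo : Set.MapsTo ψ W W'
  lineField : ∀ p ∈ W, ∀ v ∈ lineField f p, fderiv ℝ ψ p v ∈ GenWilczynski.lineField f' (ψ p)
  filtration : ∀ p ∈ W, ∀ i, ∀ v ∈ normalFiltration f i p,
    fderiv ℝ ψ p v ∈ normalFiltration f' i (ψ p)

theorem eq_smul_totalD_of_mem {q v : Jet n} (hf : DifferentiableAt ℝ f q)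
    (hv : v ∈ lineField f q) : v = v.1 • totalD f q := by
  have h := (mem_lineField hf).1 hv
  rw [normalCoord_apply, sub_eq_zero] at h
  exact Prod.ext (by simp [totalD]) h

theorem totalD_mem_lineField {q : Jet n} (hf : DifferentiableAt ℝ f q) :
    totalD f q ∈ lineField f q := by
  rw [mem_lineField hf, normalCoord_apply]
  simp [totalD]

theorem fderiv_comp_of_leftInvOn (hW : IsOpen W) (hW' : IsOpen W') (hψ : ContDiffOn ℝ ∞ ψ W)
    (hχ : ContDiffOn ℝ ∞ χ W') (hmaps : Set.MapsTo ψ W W') (hinv : Set.LeftInvOn χ ψ W) {p : Jet n}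
    (hp : p ∈ W) : (fderiv ℝ χ (ψ p)).comp (fderiv ℝ ψ p) = ContinuousLinearMap.id ℝ (Jet n) := by
  have h1 := (differentiableAt_of_contDiffOn hW hψ hp).hasFDerivAt
  have h2 := (differentiableAt_of_contDiffOn hW' hχ (hmaps hp)).hasFDerivAt
  have h3 : (χ ∘ ψ) =ᶠ[nhds p] id :=
    Filter.eventually_of_mem (hW.mem_nhds hp) fun x hx => hinv hx
  exact (h2.comp p h1).unique ((hasFDerivAt_id p).congr_of_eventuallyEq h3)

theorem fderiv_totalD (hW' : IsOpen W') (hW : IsOpen W) (hf : ContDiffOn ℝ ∞ f W)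
    (hf' : ContDiffOn ℝ ∞ f' W') (hψ : IsFilteredMap f f' W W' ψ) {p : Jet n} (hp : p ∈ W) :
    fderiv ℝ ψ p (totalD f p) = (fderiv ℝ ψ p (totalD f p)).1 • totalD f' (ψ p) :=
  eq_smul_totalD_of_mem (differentiableAt_of_contDiffOn hW' hf' (hψ.mapsTo hp))
    (hψ.lineField p hp _ (totalD_mem_lineField (differentiableAt_of_contDiffOn hW hf hp)))

/-- Transformation of the coefficients `θ i` of a normal frame under an isomorphism of filtered
equations. -/
theorem wilczynskiFun_transform (hn : 1 ≤ n) (hW : IsOpen W) (hW' : IsOpen W')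
    (hf : ContDiffOn ℝ ∞ f W) (hf' : ContDiffOn ℝ ∞ f' W') (hψ : IsFilteredMap f f' W W' ψ)
    (hχ : IsFilteredMap f' f W' W χ) (hχψ : Set.LeftInvOn χ ψ W) (hψχ : Set.LeftInvOn ψ χ W')
    {i : ℕ} (hi : i ∈ Finset.Icc 3 (n + 1)) {q : Jet n} (hq : q ∈ W) :
    wilczynskiFun f i q = (fderiv ℝ ψ q (totalD f q)).1 ^ i * wilczynskiFun f' i (ψ q) := by
  obtain ⟨S, α, β, γ, θ, hS, -⟩ := exists_isNormalFrame hn hW hf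
  obtain ⟨S', α', β', γ', θ', hS', -⟩ := exists_isNormalFrame hn hW' hf'
  set lam : Jet n → ℝ := fun p => (fderiv ℝ ψ p (totalD f p)).1 with hlamdef
  have hd : ∀ p ∈ W, DifferentiableAt ℝ f p := fun p hp => differentiableAt_of_contDiffOn hW hf hp
  have hdψ := hψ.contDiffOn.fderiv_of_isOpen (m := ∞) hW (by simp)
  have hdχ := hχ.contDiffOn.fderiv_of_isOpen (m := ∞) hW' (by simp)
  have hlam : ContDiffOn ℝ ∞ lam W := (hdψ.clm_apply (contDiffOn_totalD hf)).fst
  have hD : ∀ p ∈ W, fderiv ℝ ψ p (totalD f p) = lam p • totalD f' (ψ p) := fun p hp =>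
    fderiv_totalD hW' hW hf hf' hψ hp
  have hL : ∀ p ∈ W, (fderiv ℝ χ (ψ p)).comp (fderiv ℝ ψ p) = ContinuousLinearMap.id ℝ (Jet n) :=
    fun p hp => fderiv_comp_of_leftInvOn hW hW' hψ.contDiffOn hχ.contDiffOn hψ.mapsTo hχψ hp
  have hR : ∀ p ∈ W, (fderiv ℝ ψ p).comp (fderiv ℝ χ (ψ p)) = ContinuousLinearMap.id ℝ (Jet n) := by
    intro p hp
    have := fderiv_comp_of_leftInvOn hW' hW hχ.contDiffOn hψ.contDiffOn hχ.mapsTo hψχ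
      (hψ.mapsTo hp)
    rwa [hχψ hp] at this
  -- `D` is nonzero and the differential of `ψ` is injective.
  have hlam0 : ∀ p ∈ W, lam p ≠ 0 := by
    intro p hp h0
    have h1 : fderiv ℝ χ (ψ p) (fderiv ℝ ψ p (totalD f p)) = totalD f p :=
      DFunLike.congr_fun (hL p hp) _
    rw [hD p hp, h0, zero_smul, map_zero] at h1
    exact zero_ne_one (congrArg Prod.fst h1)
  -- The normal frame of the second equation, pulled back through the inverse map.
  set T : Fin (n + 1) → Jet n → Jet n := fun j p => fderiv ℝ χ (ψ p) (S' j (ψ p)) with hTdef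
  have hT : ∀ j, ContDiffOn ℝ ∞ (T j) W := fun j =>
    (hdχ.comp hψ.contDiffOn hψ.mapsTo).clm_apply
      ((hS'.contDiffOn j).comp hψ.contDiffOn hψ.mapsTo)
  have hχline : ∀ p ∈ W, ∀ v ∈ lineField f' (ψ p), fderiv ℝ χ (ψ p) v ∈ lineField f p := by
    intro p hp v hv
    have := hχ.lineField (ψ p) (hψ.mapsTo hp) v hv
    rwa [hχψ hp] at this
  have hmapline : ∀ p ∈ W, (lineField f' (ψ p)).map
      (fderiv ℝ χ (ψ p) : Jet n →ₗ[ℝ] Jet n) = lineField f p := by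
    intro p hp
    refine le_antisymm (Submodule.map_le_iff_le_comap.2 (hχline p hp)) fun v hv => ?_
    exact ⟨fderiv ℝ ψ p v, hψ.lineField p hp v hv, DFunLike.congr_fun (hL p hp) v⟩
  have hmapfil : ∀ p ∈ W, ∀ i, (normalFiltration f' i (ψ p)).map
      (fderiv ℝ χ (ψ p) : Jet n →ₗ[ℝ] Jet n) = normalFiltration f i p := by
    intro p hp i
    refine le_antisymm (Submodule.map_le_iff_le_comap.2 fun v hv => ?_) fun v hv => ?_
    · have := hχ.filtration (ψ p) (hψ.mapsTo hp) i v hv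
      rwa [hχψ hp] at this
    · exact ⟨fderiv ℝ ψ p v, hψ.filtration p hp i v hv, DFunLike.congr_fun (hL p hp) v⟩
  have hTfil : ∀ p ∈ W, IsFilteredFrame f T p := by
    intro p hp i
    rw [← hmapfil p hp i, ← hS'.filtration (ψ p) (hψ.mapsTo hp) i, Submodule.map_sup,
      hmapline p hp, Submodule.map_span, ← Set.image_comp]
    rfl
  have hpull : ∀ (V : Jet n → Jet n), ∀ p ∈ W,
      VectorField.pullback ℝ ψ V p = fderiv ℝ χ (ψ p) (V (ψ p)) := by
    intro V p hp
    rw [VectorField.pullback, ContinuousLinearMap.inverse_eq (hR p hp) (hL p hp)]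
  have hTconn : ∀ p ∈ W, ∀ j, VectorField.lieBracket ℝ (totalD f) (T j) p
      - lam p • ∑ k, normalForm n (α' (ψ p)) (β' (ψ p)) (γ' (ψ p)) (fun i => θ' i (ψ p)) k j • T k p
        ∈ lineField f p := by
    intro p hp j
    have hp' := hψ.mapsTo hp
    have hψp : ContDiffAt ℝ ∞ ψ p := hψ.contDiffOn.contDiffAt (hW.mem_nhds hp)
    have h1 := hχline p hp _ (hS'.connection (ψ p) hp' j)
    rw [map_sub, map_sum] at h1
    have h2 := VectorField.pullback_lieBracket (𝕜 := ℝ) (n := ∞) minSmoothness_two_le hψp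
      (differentiableAt_of_contDiffOn hW' (contDiffOn_totalD hf') hp')
      (differentiableAt_of_contDiffOn hW' (hS'.contDiffOn j) hp')
    rw [hpull _ p hp] at h2
    have hDeq : VectorField.pullback ℝ ψ (totalD f') =ᶠ[nhds p]
        fun x => (lam x)⁻¹ • totalD f x := by
      refine Filter.eventually_of_mem (hW.mem_nhds hp) fun x hx => ?_
      have h3 : fderiv ℝ χ (ψ x) (fderiv ℝ ψ x (totalD f x)) = totalD f x :=
        DFunLike.congr_fun (hL x hx) _
      rw [hD x hx, map_smul] at h3
      rw [hpull _ x hx]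
      simp only
      rw [← h3, smul_smul, inv_mul_cancel₀ (hlam0 x hx), one_smul]
    have hTeq : VectorField.pullback ℝ ψ (S' j) =ᶠ[nhds p] T j :=
      Filter.eventually_of_mem (hW.mem_nhds hp) fun x hx => hpull _ x hx
    rw [hDeq.lieBracket_vectorField_eq hTeq, VectorField.lieBracket_smul_left
      ((differentiableAt_of_contDiffOn hW hlam hp).fun_inv (hlam0 p hp))
      (differentiableAt_of_contDiffOn hW (contDiffOn_totalD hf) hp)] at h2
    rw [h2] at h1
    -- The pullback of the second `D` is `lam⁻¹ • D`. The derivative of `lam⁻¹` in the bracket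
    -- contributes a multiple of `D`, which is zero in `N`.
    have h4 := add_mem h1 (Submodule.smul_mem _ (fderiv ℝ (fun x => (lam x)⁻¹) p (T j p))
      (totalD_mem_lineField (hd p hp)))
    have h5 := Submodule.smul_mem _ (lam p) h4
    convert h5 using 1
    have h6 : (lam p) • (lam p)⁻¹ • VectorField.lieBracket ℝ (totalD f) (T j) p
        = VectorField.lieBracket ℝ (totalD f) (T j) p := by
      rw [smul_smul, mul_inv_cancel₀ (hlam0 p hp), one_smul]
    simp only [map_smul, smul_add, smul_sub, h6, neg_smul, smul_neg]
    abel
  have h := coeff_eq_of_frames hn hW hf hS.contDiffOn hT hS.filtration hTfil hlam hlam0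
    hS.connection hTconn i hi q hq
  rw [wilczynskiFun_eq hn hW hf hi hq ⟨W, S, α, β, γ, θ, hq, hS, rfl⟩,
    wilczynskiFun_eq hn hW' hf' hi (hψ.mapsTo hq) ⟨W', S', α', β', γ', θ', hψ.mapsTo hq, hS', rfl⟩]
  exact h

end FilteredMaps

/-! ### From a contact transformation to an isomorphism of filtered equations. -/

section Equivalence

variable {n : ℕ} {f f' : Jet n → ℝ} {Ω Ω' : Set (Jet n)}
  {φ : OpenPartialHomeomorph (Jet (n + 1)) (Jet (n + 1))}

/-- The map in the coordinates `(x, y_0, …, y_n)` induced by a transformation of `J^{n+1}`. -/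
def inducedMap (φ : OpenPartialHomeomorph (Jet (n + 1)) (Jet (n + 1))) (f : Jet n → ℝ)
    (q : Jet n) : Jet n := jetProj (Nat.le_succ n) (φ (embed f q))

/-- The domain of the induced map. -/
def inducedDomain (φ : OpenPartialHomeomorph (Jet (n + 1)) (Jet (n + 1))) (Ω : Set (Jet n))
    (f : Jet n → ℝ) : Set (Jet n) := Ω ∩ embed f ⁻¹' φ.source

theorem jetProj_embed (f : Jet n → ℝ) (q : Jet n) : jetProj (Nat.le_succ n) (embed f q) = q := by
  refine Prod.ext rfl (funext fun i => ?_)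
  exact Fin.snoc_castSucc (α := fun _ => ℝ) (f q) q.2 i

theorem contDiffOn_embed (hf : ContDiffOn ℝ ∞ f Ω) : ContDiffOn ℝ ∞ (embed f) Ω := by
  refine contDiffOn_fst.prodMk (contDiffOn_pi.2 fun i => ?_)
  refine Fin.lastCases ?_ (fun j => ?_) i
  · simpa using hf
  · simp only [Fin.snoc_castSucc]
    exact ((contDiff_apply ℝ ℝ j).comp contDiff_snd).contDiffOn

theorem isOpen_inducedDomain (hΩ : IsOpen Ω) (hf : ContDiffOn ℝ ∞ f Ω) :
    IsOpen (inducedDomain φ Ω f) :=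
  (contDiffOn_embed hf).continuousOn.isOpen_inter_preimage hΩ φ.open_source

/-- `hE` places the image on the second equation, and a point of that equation is recovered from its
projection to `J^n`. -/
theorem embed_inducedMap (hE : φ.IsImage (equation Ω f) (equation Ω' f')) {q : Jet n}
    (hq : q ∈ inducedDomain φ Ω f) :
    inducedMap φ f q ∈ Ω' ∧ embed f' (inducedMap φ f q) = φ (embed f q) := by
  obtain ⟨r, hr, hr'⟩ := (hE hq.2).2 ⟨q, hq.1, rfl⟩
  have : inducedMap φ f q = r := by rw [inducedMap, ← hr', jetProj_embed]
  rw [this]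
  exact ⟨hr, hr'⟩

/-- Moves the condition from `J^i` up to `J^{n+1}`, where `fderiv_mem_contactFlag` covers the line
field and all `N_i` alike. -/
theorem mem_normalFiltration_iff {q : Jet n} {i : Fin (n + 1)} {v : Jet n} :
    v ∈ normalFiltration f i q ↔ dEmbed f q v ∈ contactFlag (n + 1) i (embed f q) := by
  rw [normalFiltration, Submodule.mem_comap, mem_contactDist, mem_contactFlag]
  have := i.2
  exact ⟨fun h j _ hji => h ⟨j, by omega⟩ (by simp only; omega),
    fun h j hj => h j (by omega) (by omega)⟩

theorem mem_lineField_iff {q : Jet n} {v : Jet n} :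
    v ∈ lineField f q ↔ dEmbed f q v ∈ contactFlag (n + 1) (n + 1) (embed f q) := by
  rw [lineField, Submodule.mem_comap, contactFlag_self]

theorem contDiffOn_inducedMap (hφ : IsLocalContact φ) (hf : ContDiffOn ℝ ∞ f Ω) :
    ContDiffOn ℝ ∞ (inducedMap φ f) (inducedDomain φ Ω f) := by
  have h : ContDiffOn ℝ ∞ (fun q => φ (embed f q)) (inducedDomain φ Ω f) :=
    hφ.contDiffOn.comp ((contDiffOn_embed hf).mono fun q hq => hq.1) fun q hq => hq.2
  exact h.fst.prodMk (contDiffOn_pi.2 fun i => contDiffOn_pi.1 h.snd _)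

theorem dEmbed_fderiv_inducedMap (hΩ : IsOpen Ω) (hΩ' : IsOpen Ω') (hf : ContDiffOn ℝ ∞ f Ω)
    (hf' : ContDiffOn ℝ ∞ f' Ω') (hφ : IsLocalContact φ)
    (hE : φ.IsImage (equation Ω f) (equation Ω' f')) {q : Jet n} (hq : q ∈ inducedDomain φ Ω f)
    (v : Jet n) : dEmbed f' (inducedMap φ f q) (fderiv ℝ (inducedMap φ f) q v) =
      fderiv ℝ φ (embed f q) (dEmbed f q v) := by
  have hW := isOpen_inducedDomain (φ := φ) hΩ hf
  have h1 := (differentiableAt_of_contDiffOn hW (contDiffOn_inducedMap hφ hf) hq).hasFDerivAt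
  have h2 := (differentiableAt_of_contDiffOn hΩ' (contDiffOn_embed hf')
    (embed_inducedMap hE hq).1).hasFDerivAt
  have h3 := (differentiableAt_of_contDiffOn hΩ (contDiffOn_embed hf) hq.1).hasFDerivAt
  have h4 := (differentiableAt_of_contDiffOn φ.open_source hφ.contDiffOn hq.2).hasFDerivAt
  have h5 : (embed f' ∘ inducedMap φ f) =ᶠ[nhds q] (φ ∘ embed f) :=
    Filter.eventually_of_mem (hW.mem_nhds hq) fun x hx => (embed_inducedMap hE hx).2
  exact DFunLike.congr_fun ((h2.comp q h1).unique ((h4.comp q h3).congr_of_eventuallyEq h5)) v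

theorem isFilteredMap_inducedMap (hΩ : IsOpen Ω) (hΩ' : IsOpen Ω') (hf : ContDiffOn ℝ ∞ f Ω)
    (hf' : ContDiffOn ℝ ∞ f' Ω') (hφ : IsLocalContact φ)
    (hE : φ.IsImage (equation Ω f) (equation Ω' f')) :
    IsFilteredMap f f' (inducedDomain φ Ω f) (inducedDomain φ.symm Ω' f') (inducedMap φ f) := by
  refine ⟨contDiffOn_inducedMap hφ hf, fun q hq => ⟨(embed_inducedMap hE hq).1, ?_⟩,
    fun p hp v hv => ?_, fun p hp i v hv => ?_⟩
  · rw [Set.mem_preimage, (embed_inducedMap hE hq).2]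
    exact φ.map_source hq.2
  · rw [mem_lineField_iff] at hv ⊢
    rw [dEmbed_fderiv_inducedMap hΩ hΩ' hf hf' hφ hE hp, (embed_inducedMap hE hp).2]
    exact fderiv_mem_contactFlag hφ le_rfl _ hp.2 _ hv
  · rw [mem_normalFiltration_iff] at hv ⊢
    rw [dEmbed_fderiv_inducedMap hΩ hΩ' hf hf' hφ hE hp, (embed_inducedMap hE hp).2]
    exact fderiv_mem_contactFlag hφ (by have := i.2; omega) _ hp.2 _ hv

theorem leftInvOn_inducedMap (hE : φ.IsImage (equation Ω f) (equation Ω' f')) :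
    Set.LeftInvOn (inducedMap φ.symm f') (inducedMap φ f) (inducedDomain φ Ω f) := by
  intro q hq
  rw [inducedMap, (embed_inducedMap hE hq).2, φ.left_inv hq.2, jetProj_embed]

theorem wilczynski_apply (i : ℕ) (q : Jet n) (v : Fin i → lineField f q) :
    wilczynski f i q v = wilczynskiFun f i q * ∏ j, (v j : Jet n).1 := by
  simp [wilczynski]

end Equivalence

end GenWilczynski

end

theorem theorem3 (n : ℕ) (hn : 2 ≤ n)
    (Ω Ω' : Set (GenWilczynski.Jet n)) (hΩ : IsOpen Ω) (hΩ' : IsOpen Ω')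
    (f f' : GenWilczynski.Jet n → ℝ)
    (hf : ContDiffOn ℝ ∞ f Ω) (hf' : ContDiffOn ℝ ∞ f' Ω')
    (φ : OpenPartialHomeomorph (GenWilczynski.Jet (n + 1)) (GenWilczynski.Jet (n + 1)))
    (hφ : GenWilczynski.IsLocalContact φ)
    (hE : φ.IsImage (GenWilczynski.equation Ω f) (GenWilczynski.equation Ω' f')) :
    -- the invariants of both equations are well defined smooth sections of `S^i E^*`
    (∀ i ∈ Finset.Icc 3 (n + 1),
      (∀ q ∈ Ω, ∃! t, GenWilczynski.IsWilczynskiValue f i q t) ∧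
      ContDiffOn ℝ ∞ (GenWilczynski.wilczynskiFun f i) Ω ∧
      (∀ q ∈ Ω', ∃! t, GenWilczynski.IsWilczynskiValue f' i q t) ∧
      ContDiffOn ℝ ∞ (GenWilczynski.wilczynskiFun f' i) Ω') ∧
    -- and at corresponding points of the two equations
    ∀ q ∈ Ω, ∀ q' ∈ Ω', GenWilczynski.embed f q ∈ φ.source →
      φ (GenWilczynski.embed f q) = GenWilczynski.embed f' q' →
      -- `φ_* E = E'`
      ((GenWilczynski.lineField f q).map (GenWilczynski.dEmbed f q)).map
          (fderiv ℝ φ (GenWilczynski.embed f q) :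
            GenWilczynski.Jet (n + 1) →ₗ[ℝ] GenWilczynski.Jet (n + 1)) =
        (GenWilczynski.lineField f' q').map (GenWilczynski.dEmbed f' q') ∧
      -- `φ^* 𝓦'_i = 𝓦_i`
      ∀ i ∈ Finset.Icc 3 (n + 1),
        ∀ (v : Fin i → GenWilczynski.lineField f q)
          (v' : Fin i → GenWilczynski.lineField f' q'),
          (∀ j, fderiv ℝ φ (GenWilczynski.embed f q)
              (GenWilczynski.dEmbed f q (v j : GenWilczynski.Jet n)) =
            GenWilczynski.dEmbed f' q' (v' j : GenWilczynski.Jet n)) →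
          GenWilczynski.wilczynski f' i q' v' = GenWilczynski.wilczynski f i q v := by
  open GenWilczynski in
  have hn1 : 1 ≤ n := by omega
  refine ⟨fun i hi => ⟨fun q hq => existsUnique_isWilczynskiValue hn1 hΩ hf hi hq,
    contDiffOn_wilczynskiFun hn1 hΩ hf hi,
    fun q hq => existsUnique_isWilczynskiValue hn1 hΩ' hf' hi hq,
    contDiffOn_wilczynskiFun hn1 hΩ' hf' hi⟩, fun q hq q' hq' hsource hφq => ?_⟩
  have hqW : q ∈ inducedDomain φ Ω f := ⟨hq, hsource⟩
  have hE' : φ.symm.IsImage (equation Ω' f') (equation Ω f) := hE.symm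
  have hW := isOpen_inducedDomain (φ := φ) hΩ hf
  have hW' := isOpen_inducedDomain (φ := φ.symm) hΩ' hf'
  have hψ := isFilteredMap_inducedMap hΩ hΩ' hf hf' hφ hE
  have hχ : IsFilteredMap f' f (inducedDomain φ.symm Ω' f') (inducedDomain φ Ω f)
      (inducedMap φ.symm f') := isFilteredMap_inducedMap hΩ' hΩ hf' hf hφ.symm hE'
  have hχψ := leftInvOn_inducedMap hE
  have hψχ : Set.LeftInvOn (inducedMap φ f) (inducedMap φ.symm f')
      (inducedDomain φ.symm Ω' f') := leftInvOn_inducedMap hE'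
  have hfW := hf.mono (s := Ω) (t := inducedDomain φ Ω f) fun p hp => hp.1
  have hfW' := hf'.mono (s := Ω') (t := inducedDomain φ.symm Ω' f') fun p hp => hp.1
  -- The point `q'` is determined by `q`, so the pointwise claim concerns the induced map.
  obtain rfl : q' = inducedMap φ f q := by rw [inducedMap, hφq, jetProj_embed]
  have hd := dEmbed_fderiv_inducedMap hΩ hΩ' hf hf' hφ hE hqW
  have hdf := differentiableAt_of_contDiffOn hΩ hf hq
  have hdf' := differentiableAt_of_contDiffOn hΩ' hf' hq'
  refine ⟨le_antisymm ?_ ?_, fun i hi v v' hv => ?_⟩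
  · rw [Submodule.map_le_iff_le_comap, Submodule.map_le_iff_le_comap]
    intro v hv
    exact ⟨_, hψ.lineField q hqW v hv, hd v⟩
  · rintro _ ⟨w, hw, rfl⟩
    have h1 := hχ.lineField _ (hψ.mapsTo hqW) w hw
    rw [hχψ hqW] at h1
    refine ⟨_, ⟨_, h1, rfl⟩, ?_⟩
    have h2 := fderiv_comp_of_leftInvOn hW' hW hχ.contDiffOn hψ.contDiffOn hχ.mapsTo hψχ
      (hψ.mapsTo hqW)
    rw [hχψ hqW] at h2
    refine (hd _).symm.trans (congrArg _ ?_)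
    exact DFunLike.congr_fun h2 w
  -- On `E` the induced map multiplies the `dx`-component by `lam`. The product over the `i`
  -- arguments gives the factor `lam ^ i` of `wilczynskiFun_transform`.
  · have key : ∀ j, (v' j : Jet n).1
        = (fderiv ℝ (inducedMap φ f) q (totalD f q)).1 * (v j : Jet n).1 := by
      intro j
      have h1 := (hd (v j)).trans (hv j)
      rw [dEmbed_apply hdf', dEmbed_apply hdf'] at h1
      have h2 : (fderiv ℝ (inducedMap φ f) q (v j : Jet n)).1 = (v' j : Jet n).1 :=
        (Prod.ext_iff.1 h1).1
      rw [← h2, eq_smul_totalD_of_mem hdf (v j).2, map_smul]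
      simp [totalD, mul_comm]
    rw [wilczynski_apply, wilczynski_apply,
      wilczynskiFun_transform hn1 hW hW' hfW hfW' hψ hχ hχψ hψχ hi hqW]
    simp only [key, Finset.prod_mul_distrib, Finset.prod_const, Finset.card_univ, Fintype.card_fin]
    ring
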